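/- Let $k$ be a field and let $a_1,\dots,a_c\ge 0$ be integers. The rational normal scroll $S=S(a_1,\dots,a_c)$ is the projective variety with homogeneous coordinates $x_{j,i}$ ($1\le j\le c$, $1\le i\le a_j+1$) whose defining ideal $I_S\subset k[x_{j,i}]$ is generated by the $2\times 2$ minors of the matrix $M=[\,M_1\mid\cdots\mid M_c\,]$, where $$M_j=\begin{bmatrix} x_{j,1}&\cdots&x_{j,a_j}\\ x_{j,2}&\cdots&x_{j,a_j+1}\end{bmatrix}$$ (so $M_j$ is empty if $a_j=0$). Let $X$ be a toric variety obtained from $S$ by a (possibly empty) sequence of projections to coordinate hyperplanes: each projection forgets one of the remaining coordinates, and the variety is replaced by the closure of its image, so that its defining ideal is replaced by its contraction to the polynomial ring in the coordinates that are left. Let $I_X$ be the defining ideal of $X$ in the polynomial ring $R$ in the remaining coordinates, and let $\deg X$ be the degree of $X$ as a projective variety, that is, $r!$ times the leading coefficient of the Hilbert polynomial of $R/I_X$, where $r$ is the degree of that polynomial. Then for every term order on $R$, every element of the reduced Gröbner basis of $I_X$ has total degree at most $\deg X$. -/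

import Mathlib

open MvPolynomial

noncomputable section

namespace ScrollProjection

/-! ### Rational normal scrolls -/

/-- The homogeneous coordinates `x_{j,i}` on the ambient projective space of the scroll
`S(a_1, …, a_c)`: for each `j` there are `a_j + 1` of them. -/
abbrev Coord {c : ℕ} (a : Fin c → ℕ) : Type := Σ j : Fin c, Fin (a j + 1)

/-- The matrix `M = [M_1 | ⋯ | M_c]`, whose block `M_j` has the `a_j` columns
`(x_{j,i}, x_{j,i+1})`. -/
def scrollMatrix (k : Type*) [Field k] {c : ℕ} (a : Fin c → ℕ) :
    Matrix (Fin 2) (Σ j : Fin c, Fin (a j)) (MvPolynomial (Coord a) k) :=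
  Matrix.of ![fun p => X ⟨p.1, p.2.castSucc⟩, fun p => X ⟨p.1, p.2.succ⟩]

/-- The defining ideal of the rational normal scroll `S(a_1, …, a_c)`: the ideal `I_2(M)`
generated by the `2 × 2` minors of `scrollMatrix`. -/
def scrollIdeal (k : Type*) [Field k] {c : ℕ} (a : Fin c → ℕ) :
    Ideal (MvPolynomial (Coord a) k) :=
  Ideal.span (Set.range fun pq : (Σ j : Fin c, Fin (a j)) × (Σ j : Fin c, Fin (a j)) =>
    ((scrollMatrix k a).submatrix id ![pq.1, pq.2]).det)

/-! ### Projections to coordinate hyperplanes -/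

/-- `IsIteratedProjection I T J`: the ideal `J`, in the polynomial ring on the variables in `T`,
is the defining ideal of the variety obtained from the variety of `I` by a (possibly empty)
sequence of projections to coordinate hyperplanes, `T` being the set of coordinates that remain.
One projection forgets one coordinate `x`; on the ideals, (the closure of) the image is given by
the elimination ideal, the contraction to the polynomial ring on the variables other than `x`. -/
inductive IsIteratedProjection {σ : Type*} [Fintype σ] [DecidableEq σ] {k : Type*} [Field k]
    (I : Ideal (MvPolynomial σ k)) : (T : Finset σ) → Ideal (MvPolynomial T k) → Prop
  | start : IsIteratedProjection I Finset.univ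
      (I.comap (rename fun y : {y // y ∈ (Finset.univ : Finset σ)} => y.1))
  | project {T : Finset σ} {J : Ideal (MvPolynomial T k)} (hJ : IsIteratedProjection I T J)
      (x : σ) (hx : x ∈ T) :
      IsIteratedProjection I (T.erase x)
        (J.comap (rename fun y : {y // y ∈ T.erase x} => (⟨y.1, Finset.mem_of_mem_erase y.2⟩ : T)))

/-! ### The degree of a projective variety -/

/-- The Hilbert function of `k[x] / I`: the dimension of the image in `k[x] / I` of the space of
homogeneous polynomials of degree `s`. -/
def hilbertFunction {σ k : Type*} [Field k] (I : Ideal (MvPolynomial σ k)) (s : ℕ) : ℕ :=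
  Module.finrank k ((homogeneousSubmodule σ k s).map (Ideal.Quotient.mkₐ k I).toLinearMap)

/-- `p` is the Hilbert polynomial of `k[x] / I`. -/
def IsHilbertPolynomial {σ k : Type*} [Field k] (I : Ideal (MvPolynomial σ k))
    (p : Polynomial ℚ) : Prop :=
  ∀ᶠ s : ℕ in Filter.atTop, p.eval (s : ℚ) = (hilbertFunction I s : ℚ)

/-- The projective variety with homogeneous defining ideal `I` has degree `d`: the Hilbert
polynomial exists, and if `r` is its degree then `d` is `r !` times its leading coefficient. -/
def HasProjectiveDegree {σ k : Type*} [Field k] (I : Ideal (MvPolynomial σ k)) (d : ℕ) : Prop :=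
  ∃ p : Polynomial ℚ, IsHilbertPolynomial I p ∧
    (d : ℚ) = (p.natDegree.factorial : ℚ) * p.leadingCoeff

/-- The degree is unique. -/
theorem HasProjectiveDegree.unique {σ k : Type*} [Field k] {I : Ideal (MvPolynomial σ k)}
    {d e : ℕ} (hd : HasProjectiveDegree I d) (he : HasProjectiveDegree I e) : d = e := by
  obtain ⟨p, hp, hdp⟩ := hd
  obtain ⟨q, hq, heq⟩ := he
  have hpq : p = q := by
    obtain ⟨N, hN⟩ := Filter.eventually_atTop.1 (hp.and hq)
    refine Polynomial.eq_of_infinite_eval_eq p q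
      (Set.Infinite.mono (s := (fun n : ℕ => (n : ℚ)) '' Set.Ici N) ?_ ?_)
    · rintro _ ⟨n, hn, rfl⟩
      exact (hN n hn).1.trans (hN n hn).2.symm
    · exact (Set.Ici_infinite N).image (Nat.cast_injective.injOn)
  subst hpq
  exact_mod_cast hdp.trans heq.symm

/-! ### Reduced Gröbner bases -/

/-- `G` is a reduced Gröbner basis of `I` for the term order `m`: it generates `I`, the leading
terms of its elements generate the initial ideal of `I`, its elements have leading coefficient
`1`, and no term of an element of `G` is divisible by the leading monomial of another one. -/
structure IsReducedGroebnerBasis {σ k : Type*} [Field k] (m : MonomialOrder σ)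
    (I : Ideal (MvPolynomial σ k)) (G : Set (MvPolynomial σ k)) : Prop where
  span_eq : Ideal.span G = I
  initial_eq : Ideal.span (m.leadingTerm '' (I : Set (MvPolynomial σ k))) =
    Ideal.span (m.leadingTerm '' G)
  monic : ∀ g ∈ G, m.Monic g
  reduced : ∀ f ∈ G, ∀ g ∈ G, f ≠ g → ∀ u ∈ g.support, ¬ m.degree f ≤ u

end ScrollProjection

end

/-!
The scroll is parametrized by `x_{j,i} ↦ t_j s^i`, and its ideal is the toric ideal of this
parametrization (`scrollIdeal_eq_toricIdeal`): any two monomials with the same image can be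
connected by moves `x_{j,i} x_{l,m+1} → x_{j,i+1} x_{l,m}`, each of which is a minor. Projecting to
coordinate hyperplanes only restricts the parametrization to the remaining coordinates
(`IsIteratedProjection.eq_toricIdeal`). So the variety belongs to a set of coordinates, each of
which has a colour `j` and a position `i`. The toric ideal does not change when the positions are
shifted within each colour and divided by a common factor, so every colour may be assumed to start
at position `0`, and the positions to have greatest common divisor `1`. Let `w_j` be the largest
position in colour `j`, and `W = ∑ w_j`.

*Gröbner bases.* An element of a reduced Gröbner basis of a toric ideal is homogeneous for the fine
grading, and its leading monomial `x^u` is part of a primitive pair `(u, v)`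
(`IsReducedGroebnerBasis.exists_isPrimitivePair`). The degree of a primitive pair is at most `W`
(`IsPrimitivePair.degree_le`): after sorting by colour and position, the variables of `x^u` and
`x^v` are paired within each colour; the differences of positions sum to zero, no proper
subfamily does, and they lie in an interval of length `W`. Summed in a suitable order they have
distinct partial sums in a window with `W` elements (`card_le_of_no_zero_sum`).

*Degree.* The Hilbert function counts the pairs (multidegree, position) of the monomials of degree
`s` (`hilbertFunction_toricIdeal`). It equals the Hilbert function of the initial ideal, a monomial
ideal, hence is eventually polynomial (`isEventuallyPolynomial_fiberCount`). If `W > 0` and there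
are `r` colours, then in multidegree `N + n`, for a fixed `N`, the positions contain an interval of
length `∑ n_j w_j` (`exists_interval_add`). Summing over the `n` of degree `s` yields a lower bound
that grows like `W s^r / r!`, while the Hilbert function is `O(s^r)`, so the degree of the variety
is at least `W` (`sum_width_le_degree`). If `W = 0` there are no primitive pairs.
-/

noncomputable section

namespace ScrollProjection

/-! ### Toric ideals -/

section Toric

variable {σ k M : Type*} [Field k] [AddCommMonoid M]

/-- The fine degree of a monomial, in the grading in which the variable `x_p` has degree `γ p`. -/
def degreeMap (γ : σ → M) : (σ →₀ ℕ) →+ M := Finsupp.weight γ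

@[simp]
lemma degreeMap_single (γ : σ → M) (p : σ) (n : ℕ) :
    degreeMap γ (Finsupp.single p n) = n • γ p := by
  simp [degreeMap, Finsupp.weight_apply]

variable (k) in
/-- The monomial map `x^u ↦ t^(degreeMap γ u)` to the monoid algebra. -/
def toricMap (γ : σ → M) : MvPolynomial σ k →ₐ[k] AddMonoidAlgebra k M :=
  AddMonoidAlgebra.mapDomainAlgHom k k (degreeMap γ)

variable (k) in
/-- The toric ideal of the configuration `γ`. -/
def toricIdeal (γ : σ → M) : Ideal (MvPolynomial σ k) := RingHom.ker (toricMap k γ)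

lemma toricMap_monomial (γ : σ → M) (u : σ →₀ ℕ) (r : k) :
    toricMap k γ (monomial u r) = AddMonoidAlgebra.single (degreeMap γ u) r := by
  simp [toricMap, monomial]

lemma coeff_toricMap [DecidableEq M] (γ : σ → M) (f : MvPolynomial σ k) (y : M) :
    (toricMap k γ f).coeff y = ∑ u ∈ f.support with degreeMap γ u = y, f.coeff u := by
  conv_lhs => rw [f.as_sum, map_sum]
  simp [toricMap_monomial, Finsupp.single_apply, Finset.sum_filter]

lemma mem_toricIdeal_iff [DecidableEq M] {γ : σ → M} {f : MvPolynomial σ k} :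
    f ∈ toricIdeal k γ ↔
      ∀ y, ∑ u ∈ f.support with degreeMap γ u = y, f.coeff u = 0 := by
  rw [toricIdeal, RingHom.mem_ker, ← AddMonoidAlgebra.coeff_inj, Finsupp.ext_iff]
  simp [coeff_toricMap]

lemma monomial_sub_mem_toricIdeal {γ : σ → M} {u v : σ →₀ ℕ}
    (h : degreeMap γ u = degreeMap γ v) : monomial u (1 : k) - monomial v 1 ∈ toricIdeal k γ := by
  rw [toricIdeal, RingHom.mem_ker, map_sub, toricMap_monomial, toricMap_monomial, h, sub_self]


lemma comap_rename_toricIdeal {τ : Type*} (γ : σ → M) (e : τ → σ) :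
    (toricIdeal k γ).comap (rename e) = toricIdeal k (γ ∘ e) := by
  have h : (toricMap k γ).comp (rename e) = toricMap k (γ ∘ e) := by
    ext p : 1
    simp [X, rename_monomial, toricMap_monomial]
  ext f
  rw [Ideal.mem_comap, toricIdeal, toricIdeal, RingHom.mem_ker, RingHom.mem_ker, ← h,
    AlgHom.comp_apply]

lemma mem_toricIdeal_iff_fiber [DecidableEq M] {γ : σ → M} {f : MvPolynomial σ k} :
    f ∈ toricIdeal k γ ↔
      ∀ v, ∑ u ∈ f.support with degreeMap γ u = degreeMap γ v, f.coeff u = 0 := by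
  rw [mem_toricIdeal_iff]
  refine ⟨fun H v => H _, fun H y => ?_⟩
  by_cases hy : ∃ v, degreeMap γ v = y
  · obtain ⟨v, rfl⟩ := hy
    exact H v
  · rw [Finset.filter_false_of_mem fun u _ hu => hy ⟨u, hu⟩, Finset.sum_empty]

/-- The toric ideal only depends on which monomials have the same degree. -/
lemma toricIdeal_congr {N : Type*} [AddCommMonoid N] {γ : σ → M} {δ : σ → N}
    (h : ∀ u v, degreeMap γ u = degreeMap γ v ↔ degreeMap δ u = degreeMap δ v) :
    toricIdeal k γ = toricIdeal k δ := by
  classical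
  ext f
  simp only [mem_toricIdeal_iff_fiber, h]

/-- A toric ideal is contained in every ideal containing its pure difference binomials. -/
lemma toricIdeal_le {γ : σ → M} {I : Ideal (MvPolynomial σ k)}
    (h : ∀ u v, degreeMap γ u = degreeMap γ v → monomial u (1 : k) - monomial v 1 ∈ I) :
    toricIdeal k γ ≤ I := by
  classical
  intro f hf
  rw [mem_toricIdeal_iff] at hf
  -- modulo `I`, a monomial may be replaced by a representative of its fibre
  let rep : M → (σ →₀ ℕ) := Function.invFun (degreeMap γ)
  have hrep : ∀ u, degreeMap γ (rep (degreeMap γ u)) = degreeMap γ u := fun u =>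
    Function.invFun_eq ⟨u, rfl⟩
  have h1 : ∑ u ∈ f.support, f.coeff u • monomial (rep (degreeMap γ u)) (1 : k) = 0 := by
    rw [← Finset.sum_fiberwise_of_maps_to (s := f.support)
      (t := f.support.image (degreeMap γ)) (g := degreeMap γ)
      fun u hu => Finset.mem_image_of_mem _ hu]
    refine Finset.sum_eq_zero fun y _ => ?_
    rw [Finset.sum_congr rfl fun u hu => by rw [(Finset.mem_filter.1 hu).2], ← Finset.sum_smul,
      hf y, zero_smul]
  have h2 : f = ∑ u ∈ f.support,
      f.coeff u • (monomial u (1 : k) - monomial (rep (degreeMap γ u)) 1) := by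
    simp only [smul_sub, Finset.sum_sub_distrib]
    rw [h1, sub_zero]
    conv_lhs => rw [f.as_sum]
    simp [smul_monomial]
  rw [h2]
  exact I.sum_mem fun u _ => Submodule.smul_of_tower_mem I _ (h _ _ (hrep u).symm)

/-! ### Reduced Gröbner bases of toric ideals -/

section Groebner

variable {m : MonomialOrder σ} {I : Ideal (MvPolynomial σ k)} {G : Set (MvPolynomial σ k)}

lemma IsReducedGroebnerBasis.exists_degree_le (hG : IsReducedGroebnerBasis m I G)
    {h : MvPolynomial σ k} (hI : h ∈ I) (h0 : h ≠ 0) : ∃ f ∈ G, m.degree f ≤ m.degree h := by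
  classical
  have h1 : m.leadingTerm h ∈
      Ideal.span ((fun s => monomial s (1 : k)) '' (m.degree '' G)) := by
    have : (fun s => monomial s (1 : k)) '' (m.degree '' G) = m.leadingTerm '' G := by
      rw [Set.image_image]
      refine Set.image_congr fun f hf => ?_
      rw [MonomialOrder.leadingTerm, (hG.monic f hf).leadingCoeff_eq_one]
    rw [this, ← hG.initial_eq]
    exact Ideal.subset_span ⟨h, hI, rfl⟩
  rw [mem_ideal_span_monomial_image] at h1
  obtain ⟨_, ⟨f, hf, rfl⟩, hle⟩ := h1 (m.degree h) (by
    rw [MonomialOrder.support_leadingTerm' h0]; simp)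
  exact ⟨f, hf, hle⟩

/-- The leading monomial of an element of a reduced Gröbner basis is a minimal generator of the
initial ideal. -/
lemma IsReducedGroebnerBasis.not_lt_degree (hG : IsReducedGroebnerBasis m I G)
    {g h : MvPolynomial σ k} (hg : g ∈ G) (hI : h ∈ I) (h0 : h ≠ 0) :
    ¬ m.degree h < m.degree g := by
  intro hlt
  obtain ⟨f, hf, hle⟩ := hG.exists_degree_le hI h0
  have hne : f ≠ g := by
    rintro rfl
    exact hle.not_gt hlt
  exact hG.reduced f hf g hg hne _ (m.degree_mem_support (hG.monic g hg).ne_zero)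
    (hle.trans hlt.le)

/-- The terms of an element of a reduced Gröbner basis other than the leading one are not in the
initial ideal. -/
lemma IsReducedGroebnerBasis.not_degree_le (hG : IsReducedGroebnerBasis m I G)
    {g h : MvPolynomial σ k} (hg : g ∈ G) (hI : h ∈ I) (h0 : h ≠ 0) {v : σ →₀ ℕ}
    (hv : v ∈ g.support) (hvg : v ≠ m.degree g) : ¬ m.degree h ≤ v := by
  intro hle'
  obtain ⟨f, hf, hle⟩ := hG.exists_degree_le hI h0
  by_cases hne : f = g
  · subst hne
    refine hvg (m.toSyn.injective (le_antisymm (m.le_degree hv) ?_))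
    exact m.toSyn_monotone (hle.trans hle')
  · exact hG.reduced f hf g hg hne v hv (hle.trans hle')

lemma degree_monomial_sub {u v : σ →₀ ℕ} (h : u ≠ v) :
    monomial u (1 : k) - monomial v 1 ≠ 0 ∧
    (m.degree (monomial u (1 : k) - monomial v 1) = u ∨
      m.degree (monomial u (1 : k) - monomial v 1) = v) := by
  classical
  have h0 : monomial u (1 : k) - monomial v 1 ≠ 0 := by
    rw [sub_ne_zero]
    intro h'
    exact h ((monomial_left_injective one_ne_zero) h')
  refine ⟨h0, ?_⟩
  have h1 := MvPolynomial.support_sub _ _ _ (m.degree_mem_support h0)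
  simpa [support_monomial] using h1

/-- An element of a reduced Gröbner basis of a toric ideal is homogeneous for the fine grading. -/
lemma IsReducedGroebnerBasis.degreeMap_eq {γ : σ → M}
    (hG : IsReducedGroebnerBasis m (toricIdeal k γ) G) {g : MvPolynomial σ k} (hg : g ∈ G)
    {v : σ →₀ ℕ} (hv : v ∈ g.support) : degreeMap γ v = degreeMap γ (m.degree g) := by
  classical
  -- `h` is the part of `g` outside the fibre of the leading monomial
  let h : MvPolynomial σ k := ∑ u ∈ g.support with degreeMap γ u ≠ degreeMap γ (m.degree g),
    monomial u (g.coeff u)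
  have hc : ∀ u, h.coeff u =
      if degreeMap γ u ≠ degreeMap γ (m.degree g) then g.coeff u else 0 := by
    intro u
    simp only [h, coeff_sum, coeff_monomial, Finset.sum_ite_eq', Finset.mem_filter, mem_support_iff]
    split_ifs <;> simp_all
  have hI : h ∈ toricIdeal k γ := by
    have hgI : g ∈ toricIdeal k γ := hG.span_eq ▸ Ideal.subset_span hg
    rw [mem_toricIdeal_iff] at hgI ⊢
    intro y
    by_cases hy : y = degreeMap γ (m.degree g)
    · refine Finset.sum_eq_zero fun u hu => ?_
      rw [hc, if_neg (by simp [(Finset.mem_filter.1 hu).2, hy])]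
    · rw [← hgI y]
      have hsup : (h.support.filter fun u => degreeMap γ u = y) =
          g.support.filter fun u => degreeMap γ u = y := by
        ext u
        simp only [Finset.mem_filter, mem_support_iff, hc]
        constructor
        · rintro ⟨h1, h2⟩
          exact ⟨fun h3 => h1 (by simp [h3]), h2⟩
        · rintro ⟨h1, h2⟩
          exact ⟨by rw [if_pos (by rw [h2]; exact hy)]; exact h1, h2⟩
      rw [hsup]
      refine Finset.sum_congr rfl fun u hu => ?_
      rw [hc, if_pos (by rw [(Finset.mem_filter.1 hu).2]; exact hy)]
  by_contra hne
  have h0 : h ≠ 0 := by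
    intro h0
    have := hc v
    rw [h0, if_pos hne, coeff_zero] at this
    exact mem_support_iff.1 hv this.symm
  have h1 := mem_support_iff.1 (m.degree_mem_support h0)
  rw [hc] at h1
  split_ifs at h1 with h2
  · exact hG.not_degree_le hg hI h0 (mem_support_iff.2 h1) (fun h3 => h2 (by rw [h3])) le_rfl
  · exact h1 rfl

end Groebner

/-- Two distinct monomials `x^u`, `x^v` of the same fine degree form a *primitive* pair if a divisor
of `x^u` has the same degree as a divisor of `x^v` only when it is `1` or `x^u` itself. If only the
constant monomial has degree `0`, the binomials of these pairs form the Graver basis of the toric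
ideal. -/
structure IsPrimitivePair (γ : σ → M) (u v : σ →₀ ℕ) : Prop where
  ne : u ≠ v
  degreeMap_eq : degreeMap γ u = degreeMap γ v
  eq_zero_or_eq : ∀ u' v', u' ≤ u → v' ≤ v → degreeMap γ u' = degreeMap γ v' → u' = 0 ∨ u' = u

/-- The leading monomial of an element of a reduced Gröbner basis of a toric ideal belongs to a
primitive pair. -/
lemma IsReducedGroebnerBasis.exists_isPrimitivePair [IsLeftCancelAdd M] {m : MonomialOrder σ}
    {γ : σ → M} {G : Set (MvPolynomial σ k)}
    (hG : IsReducedGroebnerBasis m (toricIdeal k γ) G) {g : MvPolynomial σ k} (hg : g ∈ G) :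
    ∃ v, IsPrimitivePair γ (m.degree g) v := by
  classical
  have hgI : g ∈ toricIdeal k γ := hG.span_eq ▸ Ideal.subset_span hg
  have hg0 : g ≠ 0 := (hG.monic g hg).ne_zero
  -- the coefficients of `g` sum to zero, so there is a second term
  obtain ⟨v, hv, hvg⟩ : ∃ v ∈ g.support, v ≠ m.degree g := by
    by_contra! hcon
    have hs : g.support = {m.degree g} := by
      ext u
      exact ⟨fun hu => by simpa using hcon u hu, fun hu => by
        rw [Finset.mem_singleton.1 hu]; exact m.degree_mem_support hg0⟩
    have h1 := mem_toricIdeal_iff.1 hgI (degreeMap γ (m.degree g))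
    rw [hs, Finset.filter_true_of_mem (by simp), Finset.sum_singleton] at h1
    exact m.coeff_degree_ne_zero_iff.2 hg0 h1
  have hdeg := hG.degreeMap_eq hg hv
  refine ⟨v, hvg.symm, hdeg.symm, fun u' v' hu' hv' hF => ?_⟩
  by_contra! hcon
  have key : ∀ u₁ v₁, u₁ < m.degree g → v₁ ≤ v → degreeMap γ u₁ = degreeMap γ v₁ → u₁ = v₁ := by
    intro u₁ v₁ h1 h2 h3
    by_contra hne
    obtain ⟨h0, h4 | h4⟩ := degree_monomial_sub (k := k) (m := m) hne
    · exact hG.not_lt_degree hg (monomial_sub_mem_toricIdeal h3) h0 (by rwa [h4])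
    · exact hG.not_degree_le hg (monomial_sub_mem_toricIdeal h3) h0 hv hvg (by rwa [h4])
  have h1 := key u' v' (lt_of_le_of_ne hu' hcon.2) hv' hF
  subst h1
  obtain ⟨u₂, hu₂⟩ := exists_add_of_le hu'
  obtain ⟨v₂, rfl⟩ := exists_add_of_le hv'
  have h2 := key u₂ v₂ ?_ le_add_self ?_
  · exact hvg (by rw [hu₂, h2])
  · rw [hu₂]
    exact lt_of_le_of_ne le_add_self fun h => hcon.1 (by simpa using h)
  · rw [hu₂, map_add, map_add] at hdeg
    exact (add_left_cancel hdeg).symm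

end Toric

/-! ### The Hilbert function of a toric ideal -/

section HilbertFunction

variable {σ k M : Type*} [Field k] [AddCommMonoid M]

/-- The number of fine degrees of the monomials of total degree `s`. -/
def fiberCount (γ : σ → M) (s : ℕ) : ℕ := (degreeMap γ '' {u | u.degree = s}).ncard

lemma finite_setOf_degree_eq [Finite σ] (s : ℕ) : {u : σ →₀ ℕ | u.degree = s}.Finite :=
  (Finsupp.finite_of_degree_le s).subset fun _ hu => le_of_eq hu

lemma finrank_map_eq_of_ker_eq {V W W' : Type*} [AddCommGroup V] [Module k V] [AddCommGroup W]
    [Module k W] [AddCommGroup W'] [Module k W'] {f : V →ₗ[k] W} {g : V →ₗ[k] W'}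
    (h : LinearMap.ker f = LinearMap.ker g) (p : Submodule k V) :
    Module.finrank k (p.map f) = Module.finrank k (p.map g) := by
  have h1 : LinearMap.ker (f.domRestrict p) = LinearMap.ker (g.domRestrict p) := by
    simp only [LinearMap.ker_domRestrict, h]
  rw [← LinearMap.range_domRestrict, ← LinearMap.range_domRestrict,
    ← (f.domRestrict p).quotKerEquivRange.finrank_eq,
    ← (g.domRestrict p).quotKerEquivRange.finrank_eq, h1]

theorem hilbertFunction_toricIdeal [Finite σ] (γ : σ → M) (s : ℕ) :
    hilbertFunction (toricIdeal k γ) s = fiberCount γ s := by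
  classical
  have hker : LinearMap.ker (Ideal.Quotient.mkₐ k (toricIdeal k γ)).toLinearMap =
      LinearMap.ker (toricMap k γ).toLinearMap := by
    ext f
    rw [LinearMap.mem_ker, LinearMap.mem_ker, AlgHom.toLinearMap_apply, AlgHom.toLinearMap_apply,
      Ideal.Quotient.mkₐ_eq_mk, Ideal.Quotient.eq_zero_iff_mem, toricIdeal, RingHom.mem_ker]
  have hmap : (homogeneousSubmodule σ k s).map (toricMap k γ).toLinearMap =
      Submodule.span k (AddMonoidAlgebra.basis M k ''
        (degreeMap γ '' {u : σ →₀ ℕ | u.degree = s})) := by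
    rw [homogeneousSubmodule_eq_finsupp_supported, AddMonoidAlgebra.supported_eq_span_single,
      Submodule.map_span, Set.image_image, Set.image_image]
    congr 1
    refine Set.image_congr fun u _ => ?_
    rw [AddMonoidAlgebra.basis_apply]
    exact toricMap_monomial γ u (1 : k)
  rw [hilbertFunction, finrank_map_eq_of_ker_eq hker, hmap, fiberCount]
  have := ((finite_setOf_degree_eq (σ := σ) s).image (degreeMap γ)).fintype
  rw [Set.image_eq_range, ← Nat.card_coe_set_eq, Nat.card_eq_fintype_card]
  exact finrank_span_eq_card
    ((AddMonoidAlgebra.basis M k).linearIndependent.comp _ Subtype.val_injective)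

/-- The number of monomials of degree `s`. -/
lemma ncard_setOf_degree_eq [Fintype σ] (s : ℕ) :
    {u : σ →₀ ℕ | u.degree = s}.ncard = (Fintype.card σ + s - 1).choose s := by
  classical
  rw [← Sym.card_sym_eq_choose, ← Nat.card_eq_fintype_card, ← Nat.card_coe_set_eq]
  refine Nat.card_congr ((Equiv.subtypeEquivRight fun u => ?_).trans (Sym.equivNatSum σ s).symm)
  simp [Finsupp.degree_apply, Finsupp.sum]

end HilbertFunction

/-! ### Existence of the Hilbert polynomial -/

section HilbertPolynomial

open Polynomial Filter

variable {σ : Type*}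

/-- For large arguments `h` agrees with a polynomial. -/
def IsEventuallyPolynomial (h : ℕ → ℚ) : Prop :=
  ∃ p : ℚ[X], ∀ᶠ s : ℕ in atTop, p.eval (s : ℚ) = h s

lemma IsEventuallyPolynomial.sub_shift {f g h : ℕ → ℚ} {b : ℕ} (hf : IsEventuallyPolynomial f)
    (hg : IsEventuallyPolynomial g) (hh : ∀ᶠ s in atTop, h s = f s - g (s - b)) :
    IsEventuallyPolynomial h := by
  obtain ⟨p, hp⟩ := hf
  obtain ⟨q, hq⟩ := hg
  refine ⟨p - q.comp (Polynomial.X - Polynomial.C (b : ℚ)), ?_⟩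
  filter_upwards [hp, hh, (tendsto_sub_atTop_nat b).eventually hq, eventually_ge_atTop b]
    with s h1 h2 h3 h4
  rw [h2, ← h1, ← h3]
  simp [Nat.cast_sub h4]

lemma ncard_degree_eq_eval [Fintype σ] [Nonempty σ] (s : ℕ) :
    ({u : σ →₀ ℕ | u.degree = s}.ncard : ℚ) =
      (Polynomial.preHilbertPoly ℚ (Fintype.card σ - 1) 0).eval (s : ℚ) := by
  have hc : 0 < Fintype.card σ := Fintype.card_pos
  rw [Polynomial.preHilbertPoly_eq_choose_sub_add ℚ _ (Nat.zero_le s), ncard_setOf_degree_eq,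
    Nat.choose_symm_of_eq_add (show s - 0 + (Fintype.card σ - 1) = Fintype.card σ - 1 + s by
      omega)]
  congr 2
  omega

lemma isEventuallyPolynomial_ncard_degree [Finite σ] :
    IsEventuallyPolynomial fun s => ({u : σ →₀ ℕ | u.degree = s}.ncard : ℚ) := by
  have := Fintype.ofFinite σ
  rcases isEmpty_or_nonempty σ with hσ | hσ
  · refine ⟨0, ?_⟩
    filter_upwards [eventually_gt_atTop 0] with s hs
    rw [ncard_setOf_degree_eq, Fintype.card_eq_zero, Nat.choose_eq_zero_of_lt (by omega)]
    simp
  · exact ⟨_, .of_forall fun s => (ncard_degree_eq_eval s).symm⟩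

/-- The Hilbert function of a monomial ideal, given by a list of generators, is eventually
polynomial; the recursion is on the exact sequence
`0 → S/(I : x^b) → S/I → S/(I + x^b) → 0`. -/
lemma isEventuallyPolynomial_ncard_not_le [Finite σ] (B : List (σ →₀ ℕ)) :
    IsEventuallyPolynomial fun s =>
      ({u : σ →₀ ℕ | u.degree = s ∧ ∀ b ∈ B, ¬ b ≤ u}.ncard : ℚ) := by
  classical
  induction hn : B.length generalizing B with
  | zero =>
    obtain rfl := List.length_eq_zero_iff.1 hn
    simpa using isEventuallyPolynomial_ncard_degree
  | succ n ih =>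
    obtain ⟨b, B, rfl⟩ := List.exists_cons_of_length_eq_add_one hn
    have hB : B.length = n := by simpa using hn
    refine (ih B hB).sub_shift (ih (B.map (· - b)) (by simpa using hB)) (b := b.degree) ?_
    filter_upwards [eventually_ge_atTop b.degree] with s hs
    rw [eq_sub_iff_add_eq]
    have hfin : ∀ (t : ℕ) (P : (σ →₀ ℕ) → Prop), {u : σ →₀ ℕ | u.degree = t ∧ P u}.Finite :=
      fun t P => (finite_setOf_degree_eq t).subset fun u hu => hu.1
    -- the monomials divisible by `x^b` are the multiples of `x^b`
    have h1 : ({u : σ →₀ ℕ | u.degree = s - b.degree ∧ ∀ c ∈ B.map (· - b), ¬ c ≤ u}.ncard) =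
        {u : σ →₀ ℕ | u.degree = s ∧ (∀ c ∈ B, ¬ c ≤ u) ∧ b ≤ u}.ncard := by
      rw [← Set.ncard_image_of_injective _ (add_left_injective b)]
      congr 1
      ext u
      simp only [Set.mem_image, Set.mem_ofPred_eq, List.mem_map, forall_exists_index, and_imp,
        forall_apply_eq_imp_iff₂]
      constructor
      · rintro ⟨v, ⟨h2, h3⟩, rfl⟩
        refine ⟨by rw [map_add]; omega, fun c hc h4 => h3 c hc ?_, le_add_self⟩
        exact tsub_le_iff_right.2 h4
      · rintro ⟨h2, h3, h4⟩
        refine ⟨u - b, ⟨?_, fun c hc h5 => h3 c hc ?_⟩, tsub_add_cancel_of_le h4⟩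
        · have := congrArg Finsupp.degree (tsub_add_cancel_of_le h4)
          rw [map_add] at this
          omega
        · rw [← tsub_add_cancel_of_le h4]
          exact tsub_le_iff_right.1 h5
    rw [h1]
    norm_cast
    rw [← Set.ncard_union_eq _ (hfin _ _) (hfin _ _)]
    · congr 1
      ext u
      simp only [Set.mem_union, Set.mem_ofPred_eq, List.forall_mem_cons]
      tauto
    · rw [Set.disjoint_left]
      rintro u ⟨-, h2⟩ ⟨-, -, h3⟩
      exact h2 b (by simp) h3

theorem isEventuallyPolynomial_fiberCount [Finite σ] {M : Type*} [AddCommMonoid M]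
    {γ : σ → M} (hdeg : ∀ u v, degreeMap γ u = degreeMap γ v → u.degree = v.degree) :
    IsEventuallyPolynomial fun s => (fiberCount γ s : ℚ) := by
  classical
  have := Fintype.ofFinite σ
  let _ : LinearOrder σ := LinearOrder.lift' (Fintype.equivFin σ) (Fintype.equivFin σ).injective
  let m : MonomialOrder σ := MonomialOrder.lex
  -- the monomials that are not minimal in their fibre
  let U : Set (σ →₀ ℕ) := {u | ∃ v, degreeMap γ v = degreeMap γ u ∧ m.toSyn v < m.toSyn u}
  have hU : ∀ u v, u ∈ U → u ≤ v → v ∈ U := by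
    rintro u v ⟨w, hw, hlt⟩ huv
    obtain ⟨z, rfl⟩ := exists_add_of_le huv
    exact ⟨w + z, by rw [map_add, map_add, hw], by rw [map_add, map_add]; gcongr⟩
  have hfin : {b | Minimal (· ∈ U) b}.Finite :=
    WellQuasiOrderedLE.finite_of_isAntichain (setOfPred_minimal_antichain _)
  obtain ⟨B, hmem⟩ : ∃ B : List (σ →₀ ℕ), ∀ u, u ∈ U ↔ ∃ b ∈ B, b ≤ u := by
    refine ⟨hfin.toFinset.toList, fun u => ?_⟩
    simp only [Finset.mem_toList, Set.Finite.mem_toFinset, Set.mem_ofPred_eq]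
    constructor
    · intro hu
      obtain ⟨b, hb, hmin⟩ := (Set.isPWO_of_wellQuasiOrderedLE U).exists_le_minimal hu
      exact ⟨b, hmin, hb⟩
    · rintro ⟨b, hb, hbu⟩
      exact hU b u hb.prop hbu
  convert isEventuallyPolynomial_ncard_not_le B using 3 with s
  have hset : {u : σ →₀ ℕ | u.degree = s ∧ ∀ b ∈ B, ¬ b ≤ u} =
      {u | u.degree = s ∧ u ∉ U} := by
    ext u
    simp only [Set.mem_ofPred_eq, hmem]
    push Not
    rfl
  rw [hset, fiberCount]
  have himage : degreeMap γ '' {u | u.degree = s} = degreeMap γ '' {u | u.degree = s ∧ u ∉ U} := by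
    refine subset_antisymm ?_ (Set.image_mono fun u hu => hu.1)
    rintro _ ⟨u, hu, rfl⟩
    obtain ⟨v, hv, hmin⟩ := WellFounded.has_min (InvImage.wf m.toSyn wellFounded_lt)
      {v | degreeMap γ v = degreeMap γ u} ⟨u, rfl⟩
    refine ⟨v, ⟨(hdeg v u hv).trans hu, ?_⟩, hv⟩
    rintro ⟨w, hw, hlt⟩
    exact hmin w (hw.trans hv) hlt
  rw [himage, Set.InjOn.ncard_image]
  rintro u ⟨-, hu⟩ v ⟨-, hv⟩ huv
  by_contra hne
  rcases lt_or_gt_of_ne (m.toSyn.injective.ne hne) with h | h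
  · exact hv ⟨u, huv, h⟩
  · exact hu ⟨v, huv.symm, h⟩

lemma leadingCoeff_nonneg_of_eventually_nonneg {p : ℚ[X]}
    (hp : ∀ᶠ s : ℕ in atTop, 0 ≤ p.eval (s : ℚ)) : 0 ≤ p.leadingCoeff := by
  by_contra! hneg
  rcases le_or_gt p.degree 0 with h0 | h0
  · obtain ⟨s, hs⟩ := hp.exists
    obtain ⟨c, rfl⟩ := natDegree_eq_zero.1 (natDegree_eq_zero_iff_degree_le_zero.2 h0)
    rw [Polynomial.eval_C] at hs
    rw [leadingCoeff_C] at hneg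
    exact hneg.not_ge hs
  · obtain ⟨s, hs, hs'⟩ := (hp.and (((p.tendsto_atBot_of_leadingCoeff_nonpos h0 hneg.le).comp
      tendsto_natCast_atTop_atTop).eventually_lt_atBot 0)).exists
    exact hs'.not_ge hs

/-- If a polynomial of degree `r` takes natural numbers as values at all large natural numbers,
then `r !` times its leading coefficient is a natural number. -/
lemma exists_natCast_eq_factorial_mul_leadingCoeff {p : ℚ[X]} {h : ℕ → ℕ}
    (hp : ∀ᶠ s : ℕ in atTop, p.eval (s : ℚ) = h s) :
    ∃ d : ℕ, (d : ℚ) = (p.natDegree.factorial : ℚ) * p.leadingCoeff := by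
  obtain ⟨N, hN⟩ := eventually_atTop.1 hp
  -- the `r`-th finite difference is constant
  have h1 := congrFun p.fwdDiff_iter_degree_eq_factorial (N : ℚ)
  rw [fwdDiff_iter_eq_sum_shift] at h1
  have h2 : ∃ z : ℤ, (z : ℚ) = (p.natDegree.factorial : ℚ) * p.leadingCoeff := by
    refine ⟨∑ i ∈ Finset.range (p.natDegree + 1),
      ((-1 : ℤ) ^ (p.natDegree - i) * p.natDegree.choose i) • (h (N + i) : ℤ), ?_⟩
    rw [mul_comm]
    simp only [Pi.smul_apply, smul_eq_mul, Pi.natCast_apply] at h1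
    rw [← h1]
    push_cast
    refine Finset.sum_congr rfl fun i _ => ?_
    have := hN (N + i) (by omega)
    push_cast at this
    simp [this]
  obtain ⟨z, hz⟩ := h2
  have hlc : 0 ≤ p.leadingCoeff :=
    leadingCoeff_nonneg_of_eventually_nonneg (hp.mono fun s hs => by rw [hs]; positivity)
  have hz0 : 0 ≤ z := by
    have : (0 : ℚ) ≤ z := by rw [hz]; positivity
    exact_mod_cast this
  lift z to ℕ using hz0
  exact ⟨z, by rw [← hz, Int.cast_natCast]⟩

end HilbertPolynomial

/-! ### The degree of a primitive pair -/

section Primitive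

/-- Integers with sum zero, without a proper zero-sum subfamily, are bounded in number by the
distance `W` between the largest and the smallest of them: added up in a suitable order, they have
partial sums that stay in a window of length `W`, and these must be distinct. -/
lemma card_le_of_no_zero_sum {ι : Type*} [Fintype ι] [Nonempty ι] {d : ι → ℤ} {W : ℕ}
    (hsum : ∑ i, d i = 0) (hne : ∀ i, d i ≠ 0)
    (hW : ∀ i j, 0 < d i → d j < 0 → d i - d j ≤ W)
    (hprim : ∀ S : Finset ι, ∑ i ∈ S, d i = 0 → S = ∅ ∨ S = Finset.univ) :
    Fintype.card ι ≤ W := by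
  classical
  have hneg : ∀ S : Finset ι, S.Nonempty → ∑ i ∈ S, d i ≤ 0 → ∃ i ∈ S, d i < 0 := by
    intro S hS h
    by_contra! hcon
    exact h.not_gt (Finset.sum_pos (fun i hi => lt_of_le_of_ne (hcon i hi) (hne i).symm) hS)
  have hpos : ∀ S : Finset ι, S.Nonempty → 0 ≤ ∑ i ∈ S, d i → ∃ i ∈ S, 0 < d i := by
    intro S hS h
    by_contra! hcon
    exact h.not_gt (Finset.sum_neg (fun i hi => lt_of_le_of_ne (hcon i hi) (hne i)) hS)
  obtain ⟨p, hp0, hp⟩ : ∃ p, 0 < d p ∧ ∀ i, d i ≤ d p := by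
    obtain ⟨p, hp⟩ := Finite.exists_max d
    obtain ⟨i, -, hi⟩ := hpos Finset.univ Finset.univ_nonempty hsum.ge
    exact ⟨p, hi.trans_le (hp i), hp⟩
  obtain ⟨q, hq0, hq⟩ : ∃ q, d q < 0 ∧ ∀ i, d q ≤ d i := by
    obtain ⟨q, hq⟩ := Finite.exists_min d
    obtain ⟨i, -, hi⟩ := hneg Finset.univ Finset.univ_nonempty hsum.le
    exact ⟨q, (hq i).trans_lt hi, hq⟩
  -- a chain of subsets whose sums lie in the window
  have hchain : ∀ n ≤ Fintype.card ι, ∃ S : ℕ → Finset ι, (∀ m ≤ n, (S m).card = m) ∧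
      (∀ m < n, S m ⊆ S (m + 1)) ∧ ∀ m ≤ n, ∑ i ∈ S m, d i ∈ Finset.Ioc (d q) (d p) := by
    intro n
    induction n with
    | zero =>
      intro _
      refine ⟨fun _ => ∅, by simp, by simp, fun m _ => ?_⟩
      simp only [Finset.sum_empty, Finset.mem_Ioc]
      omega
    | succ n ih =>
      intro hn
      obtain ⟨S, h1, h2, h3⟩ := ih (by omega)
      have hcompl : (S n)ᶜ.Nonempty := by
        rw [← Finset.card_pos, Finset.card_compl, h1 n le_rfl]
        omega
      have hadd := Finset.sum_add_sum_compl (S n) d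
      have h4 := Finset.mem_Ioc.1 (h3 n le_rfl)
      obtain ⟨i, hi, hi'⟩ : ∃ i ∈ (S n)ᶜ, ∑ i ∈ S n, d i + d i ∈ Finset.Ioc (d q) (d p) := by
        simp only [Finset.mem_Ioc]
        rcases le_or_gt (∑ i ∈ S n, d i) 0 with h | h
        · obtain ⟨i, hi, hi'⟩ := hpos _ hcompl (by omega)
          exact ⟨i, hi, by omega, by have := hp i; omega⟩
        · obtain ⟨i, hi, hi'⟩ := hneg _ hcompl (by omega)
          exact ⟨i, hi, by have := hq i; omega, by omega⟩
      rw [Finset.mem_compl] at hi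
      refine ⟨fun m => if m ≤ n then S m else insert i (S n), fun m hm => ?_, fun m hm => ?_,
        fun m hm => ?_⟩
      · beta_reduce
        split_ifs with h
        · exact h1 m h
        · rw [Finset.card_insert_of_notMem hi, h1 n le_rfl]
          omega
      · by_cases h : m + 1 ≤ n
        · simp only [h, if_true, show m ≤ n by omega]
          exact h2 m (by omega)
        · obtain rfl : m = n := by omega
          simp
      · beta_reduce
        split_ifs with h
        · exact h3 m h
        · rw [Finset.sum_insert hi, add_comm]
          exact hi'
  obtain ⟨S, h1, h2, h3⟩ := hchain _ le_rfl
  have hmono : ∀ a b, a ≤ b → b ≤ Fintype.card ι → S a ⊆ S b := by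
    intro a b hab
    induction b, hab using Nat.le_induction with
    | base => exact fun _ => subset_rfl
    | succ b hab ih => exact fun hb => (ih (by omega)).trans (h2 b (by omega))
  by_contra! hlt
  -- two of the partial sums agree
  obtain ⟨a, ha, b, hb, hab, heq⟩ := Finset.exists_ne_map_eq_of_card_lt_of_maps_to
    (s := Finset.range (Fintype.card ι)) (t := Finset.Ioc (d q) (d p))
    (f := fun m => ∑ i ∈ S m, d i) (by
      rw [Int.card_Ioc, Finset.card_range]
      have := hW p q hp0 hq0
      omega)
    (fun m hm => h3 m (Finset.mem_range.1 hm).le)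
  wlog hlt' : a < b generalizing a b
  · exact this b hb a ha hab.symm heq.symm (by omega)
  rw [Finset.mem_range] at ha hb
  have hsub := hmono a b hlt'.le hb.le
  have hsd := Finset.sum_sdiff (f := d) hsub
  have hcard := Finset.card_sdiff_add_card_eq_card hsub
  rw [h1 a ha.le, h1 b hb.le] at hcard
  rcases hprim (S b \ S a) (by omega) with h | h
  · rw [h, Finset.card_empty] at hcard
    omega
  · rw [h, Finset.card_univ] at hcard
    omega

variable {σ ι : Type*}

/-- The fine degree of the coordinates: a coordinate `p` of colour `κ p` at position `φ p`
is sent to the point `(e_{κ p}, φ p)`. -/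
def colorDegree (κ : σ → ι) (φ : σ → ℕ) (p : σ) : (ι →₀ ℕ) × ℕ := (Finsupp.single (κ p) 1, φ p)

lemma degreeMap_colorDegree (κ : σ → ι) (φ : σ → ℕ) (u : σ →₀ ℕ) :
    degreeMap (colorDegree κ φ) u = (u.mapDomain κ, Finsupp.weight φ u) := by
  induction u using Finsupp.induction_linear with
  | zero => simp [Prod.zero_eq_mk]
  | add u v hu hv => simp [map_add, hu, hv, Finsupp.mapDomain_add]
  | single p n => simp [colorDegree, Finsupp.mapDomain_single, Finsupp.weight_apply]

lemma degree_mapDomain {τ : Type*} (κ : σ → τ) (u : σ →₀ ℕ) :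
    (u.mapDomain κ).degree = u.degree := by
  induction u using Finsupp.induction_linear with
  | zero => simp
  | add u v hu hv => simp [hu, hv, Finsupp.mapDomain_add]
  | single p n => simp [Finsupp.mapDomain_single]

lemma degree_eq_of_degreeMap_colorDegree_eq {κ : σ → ι} {φ : σ → ℕ} {u v : σ →₀ ℕ}
    (h : degreeMap (colorDegree κ φ) u = degreeMap (colorDegree κ φ) v) : u.degree = v.degree := by
  rw [degreeMap_colorDegree, degreeMap_colorDegree, Prod.mk.injEq] at h
  rw [← degree_mapDomain κ u, h.1, degree_mapDomain]

lemma toMultiset_sum_single {τ : Type*} {n : ℕ} (f : Fin n → τ) :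
    Finsupp.toMultiset (∑ i, Finsupp.single (f i) 1) = (List.ofFn f : Multiset τ) := by
  rw [map_sum, ← Multiset.sum_map_singleton (List.ofFn f : Multiset τ), Multiset.map_coe,
    List.map_ofFn, Multiset.sum_coe, List.sum_ofFn]
  simp

/-- A monomial as a product of variables, listed in increasing order with respect to `f`. -/
lemma exists_eq_sum_single {α : Type*} [LinearOrder α] (f : σ → α) (u : σ →₀ ℕ) {n : ℕ}
    (hn : u.degree = n) : ∃ P : Fin n → σ, u = ∑ i, Finsupp.single (P i) 1 ∧ Monotone (f ∘ P) := by
  classical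
  have h1 : ∃ P : Fin n → σ, u = ∑ i, Finsupp.single (P i) 1 := by
    obtain ⟨l, hl⟩ := Quot.exists_rep (Finsupp.toMultiset u)
    have hlen : l.length = n := by
      rw [← hn, ← Multiset.coe_card]
      have : (l : Multiset σ) = Finsupp.toMultiset u := hl
      rw [this, Finsupp.card_toMultiset]
      simp [Finsupp.degree_apply, Finsupp.sum]
    subst hlen
    refine ⟨l.get, (Function.LeftInverse.injective Finsupp.toMultiset_toFinsupp) ?_⟩
    rw [toMultiset_sum_single, List.ofFn_get]
    exact hl.symm
  obtain ⟨P, rfl⟩ := h1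
  refine ⟨P ∘ Tuple.sort (f ∘ P), ?_, Tuple.monotone_sort (f ∘ P)⟩
  exact (Equiv.sum_comp (Tuple.sort (f ∘ P)) fun i => Finsupp.single (P i) 1).symm

lemma eq_of_monotone_of_sum_single_eq {α : Type*} [LinearOrder α] {n : ℕ} {f g : Fin n → α}
    (hf : Monotone f) (hg : Monotone g)
    (h : ∑ i, Finsupp.single (f i) 1 = ∑ i, Finsupp.single (g i) (1 : ℕ)) : f = g := by
  have h1 : (List.ofFn f).Perm (List.ofFn g) := by
    rw [← Multiset.coe_eq_coe]
    rw [← toMultiset_sum_single, h, toMultiset_sum_single]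
  refine List.ofFn_injective (h1.eq_of_pairwise (le := (· ≤ ·)) (fun a b _ _ => le_antisymm) ?_ ?_)
  · exact (List.sortedLE_ofFn_iff.2 hf).pairwise
  · exact (List.sortedLE_ofFn_iff.2 hg).pairwise

/-- A primitive pair of monomials in coloured variables has degree at most the sum of the
widths of the colours. Sorting the variables of the two monomials by colour and position and
pairing them up, differences of opposite sign in the same colour belong to non-overlapping
intervals. -/
theorem IsPrimitivePair.degree_le [LinearOrder ι] [Fintype ι] {κ : σ → ι} {φ : σ → ℕ} {w : ι → ℕ}
    (hinj : Function.Injective (colorDegree κ φ))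
    (hw : ∀ p q, κ p = κ q → φ p ≤ φ q + w (κ q)) {u v : σ →₀ ℕ}
    (h : IsPrimitivePair (colorDegree κ φ) u v) : u.degree ≤ ∑ j, w j := by
  classical
  obtain ⟨n, hn⟩ : ∃ n, u.degree = n := ⟨_, rfl⟩
  have hnv : v.degree = n := (degree_eq_of_degreeMap_colorDegree_eq h.degreeMap_eq).symm.trans hn
  obtain ⟨P, rfl, hP⟩ := exists_eq_sum_single (fun p => toLex (κ p, φ p)) u hn
  obtain ⟨Q, rfl, hQ⟩ := exists_eq_sum_single (fun p => toLex (κ p, φ p)) v hnv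
  have hdeg := h.degreeMap_eq
  simp only [degreeMap_colorDegree, Prod.mk.injEq] at hdeg
  obtain ⟨hdeg1, hdeg2⟩ := hdeg
  have hcol : κ ∘ P = κ ∘ Q := by
    refine eq_of_monotone_of_sum_single_eq ?_ ?_ ?_
    · exact fun i j hij => Prod.Lex.monotone_fst _ _ (hP hij)
    · exact fun i j hij => Prod.Lex.monotone_fst _ _ (hQ hij)
    · simpa [Finsupp.mapDomain_finsetSum, Finsupp.mapDomain_single] using hdeg1
  have hcol' : ∀ i, κ (P i) = κ (Q i) := congrFun hcol
  have hPle : ∀ i j, i ≤ j → κ (P i) = κ (P j) → φ (P i) ≤ φ (P j) := by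
    intro i j hij hk
    have := Prod.Lex.le_iff.1 (hP hij)
    simp only [Function.comp_apply, ofLex_toLex, hk, lt_self_iff_false, true_and, false_or] at this
    exact this
  have hQle : ∀ i j, i ≤ j → κ (Q i) = κ (Q j) → φ (Q i) ≤ φ (Q j) := by
    intro i j hij hk
    have := Prod.Lex.le_iff.1 (hQ hij)
    simp only [Function.comp_apply, ofLex_toLex, hk, lt_self_iff_false, true_and, false_or] at this
    exact this
  have hweight : ∀ (S : Finset (Fin n)) (R : Fin n → σ),
      Finsupp.weight φ (∑ i ∈ S, Finsupp.single (R i) 1) = ∑ i ∈ S, φ (R i) := by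
    intro S R
    simp [map_sum, Finsupp.weight_apply]
  rw [hweight, hweight] at hdeg2
  rw [hn]
  have hn0 : 0 < n := by
    rcases Nat.eq_zero_or_pos n with rfl | h0
    · exact absurd (by simp) h.ne
    · exact h0
  have : Nonempty (Fin n) := ⟨⟨0, hn0⟩⟩
  have hsub : ∀ (S : Finset (Fin n)) (R : Fin n → σ),
      ∑ i ∈ S, Finsupp.single (R i) 1 ≤ ∑ i, Finsupp.single (R i) 1 := fun S R =>
    Finset.sum_le_sum_of_subset (Finset.subset_univ S)
  have hprim : ∀ S : Finset (Fin n), ∑ i ∈ S, ((φ (P i) : ℤ) - φ (Q i)) = 0 →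
      S = ∅ ∨ S = Finset.univ := by
    intro S hS
    have h1 := h.eq_zero_or_eq _ _ (hsub S P) (hsub S Q) (by
      rw [degreeMap_colorDegree, degreeMap_colorDegree, hweight, hweight, Prod.mk.injEq]
      refine ⟨by simp [Finsupp.mapDomain_finsetSum, Finsupp.mapDomain_single, hcol'], ?_⟩
      rw [Finset.sum_sub_distrib, sub_eq_zero] at hS
      exact_mod_cast hS)
    rcases h1 with h1 | h1
    · left
      simpa using congrArg Finsupp.degree h1
    · right
      rw [← Finset.card_eq_iff_eq_univ, Fintype.card_fin]
      simpa using congrArg Finsupp.degree h1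
  have hcard := card_le_of_no_zero_sum (ι := Fin n) (d := fun i => (φ (P i) : ℤ) - φ (Q i))
    (W := ∑ j, w j) ?_ ?_ ?_ hprim
  · simpa using hcard
  · rw [Finset.sum_sub_distrib, sub_eq_zero]
    exact_mod_cast hdeg2
  · intro i hi
    have hPQ : P i = Q i := hinj (by
      simp only [colorDegree, hcol' i, Prod.mk.injEq, true_and]
      omega)
    rcases hprim {i} (by simpa using hi) with h1 | h1
    · simp at h1
    · refine h.ne ?_
      rw [← h1, Finset.sum_singleton, Finset.sum_singleton, hPQ]
  · intro i j hi hj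
    by_cases hk : κ (P i) = κ (P j)
    · have hkQ : κ (Q i) = κ (Q j) := by rw [← hcol', ← hcol', hk]
      have hle : w (κ (P j)) ≤ ∑ j, w j := Finset.single_le_sum (fun _ _ => Nat.zero_le _)
        (Finset.mem_univ _)
      rcases le_total i j with hij | hij
      · have h1 := hPle i j hij hk
        have h2 := hw (Q j) (Q i) hkQ.symm
        rw [← hcol' i, hk] at h2
        omega
      · have h1 := hQle j i hij hkQ.symm
        have h2 := hw (P i) (P j) hk
        omega
    · have h1 := hw (P i) (Q i) (hcol' i)
      have h2 := hw (Q j) (P j) (hcol' j).symm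
      rw [← hcol' i] at h1
      have h3 : w (κ (P i)) + w (κ (P j)) ≤ ∑ j, w j := by
        rw [← Finset.sum_pair hk]
        exact Finset.sum_le_sum_of_subset (Finset.subset_univ _)
      omega

end Primitive

/-! ### Growth of the Hilbert function -/

section Growth

variable {σ ι : Type*} [Fintype σ]

/-- If the positions have no common factor, every residue class is the position of a monomial. -/
lemma exists_weight_modEq {φ : σ → ℕ} (hgcd : Finset.univ.gcd φ = 1) {w : ℕ} (hw : 0 < w) (b : ℕ) :
    ∃ u : σ →₀ ℕ, Finsupp.weight φ u ≡ b [MOD w] := by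
  classical
  obtain ⟨c, hc⟩ := Finset.gcd_eq_sum_mul Finset.univ fun p => (φ p : ℤ)
  have h1 : Finset.univ.gcd (fun p => (φ p : ℤ)) = 1 := by
    have h2 : (Finset.univ.gcd fun p => (φ p : ℤ)).natAbs ∣ Finset.univ.gcd φ :=
      Finset.dvd_gcd fun p hp => by
        have := Int.natAbs_dvd_natAbs.2 (Finset.gcd_dvd (f := fun p => (φ p : ℤ)) hp)
        simpa using this
    rw [hgcd, Nat.dvd_one] at h2
    rw [← Finset.normalize_gcd, ← Int.abs_eq_normalize, Int.abs_eq_natAbs, h2, Nat.cast_one]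
  rw [h1] at hc
  refine ⟨Finsupp.equivFunOnFinite.symm fun p => ((b * c p) % w : ℤ).toNat, ?_⟩
  rw [← Int.natCast_modEq_iff, Finsupp.weight_eq_sum]
  have h3 : ∀ p, (((b * c p) % w : ℤ).toNat : ℤ) = (b * c p) % w := fun p =>
    Int.toNat_of_nonneg (Int.emod_nonneg _ (by omega))
  simp only [Finsupp.equivFunOnFinite_symm_apply_apply, smul_eq_mul]
  push_cast
  simp only [h3]
  calc ∑ p, (b * c p) % w * (φ p : ℤ) ≡ ∑ p, (b * c p) * (φ p : ℤ) [ZMOD w] := by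
        refine Int.ModEq.sum fun p _ => (Int.mod_modEq _ _).mul_right _
    _ = b := by
        conv_rhs => rw [← mul_one (b : ℤ), hc, Finset.mul_sum]
        exact Finset.sum_congr rfl fun p _ => by ring

variable {κ : σ → ι} {φ : σ → ℕ} {w : ι → ℕ} {bot top : ι → σ}

/-- For some multidegree `N`, the positions of the monomials of multidegree `N` contain intervals
of any given length. -/
lemma exists_interval (hbot : ∀ j, κ (bot j) = j) (hbot' : ∀ j, φ (bot j) = 0)
    (hgcd : Finset.univ.gcd φ = 1) (L : ℕ) :
    ∃ (N : ι →₀ ℕ) (K : ℕ), ∀ x, K ≤ x → x ≤ K + L →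
      ∃ u : σ →₀ ℕ, u.mapDomain κ = N ∧ Finsupp.weight φ u = x := by
  classical
  obtain ⟨p, hp⟩ : ∃ p, 0 < φ p := by
    by_contra! hcon
    have : Finset.univ.gcd φ = 0 := Finset.gcd_eq_zero_iff.2 fun p _ => Nat.le_zero.1 (hcon p)
    omega
  choose u hu using exists_weight_modEq hgcd hp
  -- multiplying by variables in position zero makes the multidegree independent of the residue
  have hpad : ∀ n : ι →₀ ℕ, (n.mapDomain bot).mapDomain κ = n ∧
      Finsupp.weight φ (n.mapDomain bot) = 0 := by
    intro n
    constructor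
    · rw [← Finsupp.mapDomain_comp, show κ ∘ bot = id from funext hbot, Finsupp.mapDomain_id]
    · induction n using Finsupp.induction_linear with
      | zero => simp
      | add m n hm hn => rw [Finsupp.mapDomain_add, map_add, hm, hn]
      | single j n => simp [Finsupp.mapDomain_single, Finsupp.weight_apply, hbot']
  let N₀ : ι →₀ ℕ := ∑ b ∈ Finset.range (φ p), (u b).mapDomain κ
  let K : ℕ := ∑ b ∈ Finset.range (φ p), Finsupp.weight φ (u b)
  let t : ℕ := K + L
  refine ⟨N₀ + Finsupp.single (κ p) t, K, fun x hx1 hx2 => ?_⟩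
  have hb : x % φ p ∈ Finset.range (φ p) := Finset.mem_range.2 (Nat.mod_lt _ hp)
  have hle : Finsupp.weight φ (u (x % φ p)) ≤ K :=
    Finset.single_le_sum (f := fun b => Finsupp.weight φ (u b)) (fun _ _ => Nat.zero_le _) hb
  have hmod : Finsupp.weight φ (u (x % φ p)) ≡ x [MOD φ p] := (hu _).trans (Nat.mod_modEq _ _)
  obtain ⟨β, hβ⟩ := (Nat.modEq_iff_dvd' (hle.trans hx1)).1 hmod
  have hβt : β ≤ t := by
    have : β ≤ φ p * β := Nat.le_mul_of_pos_left _ hp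
    omega
  refine ⟨u (x % φ p) + Finsupp.single p β +
    ((∑ b ∈ (Finset.range (φ p)).erase (x % φ p), (u b).mapDomain κ).mapDomain bot +
      (Finsupp.single (κ p) (t - β)).mapDomain bot), ?_, ?_⟩
  · simp only [Finsupp.mapDomain_add, (hpad _).1]
    rw [show N₀ = (u (x % φ p)).mapDomain κ +
      ∑ b ∈ (Finset.range (φ p)).erase (x % φ p), (u b).mapDomain κ from
        (Finset.add_sum_erase _ _ hb).symm, Finsupp.mapDomain_single,
      show Finsupp.single (κ p) t = Finsupp.single (κ p) β + Finsupp.single (κ p) (t - β) by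
        rw [← Finsupp.single_add, Nat.add_sub_cancel' hβt]]
    abel
  · simp only [map_add, (hpad _).2]
    rw [show Finsupp.weight φ (Finsupp.single p β) = φ p * β by
      simp [Finsupp.weight_apply, mul_comm]]
    omega

/-- The positions of the monomials of multidegree `n`. -/
def positions (κ : σ → ι) (φ : σ → ℕ) (n : ι →₀ ℕ) : Set ℕ :=
  {x | ∃ u : σ →₀ ℕ, u.mapDomain κ = n ∧ Finsupp.weight φ u = x}

lemma positions_subset (κ : σ → ι) (φ : σ → ℕ) (n : ι →₀ ℕ) :
    positions κ φ n ⊆ Set.Iic ((∑ p, φ p) * n.degree) := by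
  rintro _ ⟨u, rfl, rfl⟩
  rw [degree_mapDomain, Set.mem_Iic, Finsupp.weight_eq_sum, Finset.sum_mul]
  refine Finset.sum_le_sum fun p _ => ?_
  rw [smul_eq_mul, mul_comm]
  gcongr
  exact Finsupp.le_degree p u

lemma finite_positions (κ : σ → ι) (φ : σ → ℕ) (n : ι →₀ ℕ) : (positions κ φ n).Finite :=
  (Set.finite_Iic _).subset (positions_subset κ φ n)

variable [Fintype ι]

/-- The interval of `exists_interval` grows at the rate given by the widths of the colours. -/
lemma exists_interval_add (hbot : ∀ j, κ (bot j) = j) (hbot' : ∀ j, φ (bot j) = 0)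
    (htop : ∀ j, κ (top j) = j) (htop' : ∀ j, φ (top j) = w j) (hgcd : Finset.univ.gcd φ = 1) :
    ∃ (N : ι →₀ ℕ) (K : ℕ), ∀ (n : ι →₀ ℕ) (x : ℕ), K ≤ x → x ≤ K + Finsupp.weight w n →
      ∃ u : σ →₀ ℕ, u.mapDomain κ = N + n ∧ Finsupp.weight φ u = x := by
  classical
  obtain ⟨N, K, hN⟩ := exists_interval hbot hbot' hgcd (∑ j, w j)
  refine ⟨N, K, fun n x hx1 hx2 => ?_⟩
  suffices h : ∀ (s : Multiset ι) (x : ℕ), K ≤ x →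
      x ≤ K + ∑ j, w j + Finsupp.weight w (Multiset.toFinsupp s) →
      ∃ u : σ →₀ ℕ, u.mapDomain κ = N + Multiset.toFinsupp s ∧ Finsupp.weight φ u = x by
    have := h (Finsupp.toMultiset n) x hx1
    rw [Finsupp.toMultiset_toFinsupp] at this
    exact this (by omega)
  intro s
  induction s using Multiset.induction_on with
  | empty =>
    intro x h1 h2
    rw [map_zero, map_zero, add_zero] at h2
    rw [map_zero, add_zero]
    exact hN x h1 h2
  | cons j s ih =>
    intro x h1 h2
    have hwj : w j ≤ ∑ j, w j :=
      Finset.single_le_sum (fun _ _ => Nat.zero_le _) (Finset.mem_univ j)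
    have hcons : Multiset.toFinsupp (j ::ₘ s) = Finsupp.single j 1 + Multiset.toFinsupp s := by
      rw [← Multiset.singleton_add, map_add, Multiset.toFinsupp_singleton]
    have hwt : Finsupp.weight w (Finsupp.single j 1) = w j := by simp [Finsupp.weight_apply]
    rw [hcons, map_add, hwt] at h2
    by_cases h3 : x ≤ K + ∑ j, w j + Finsupp.weight w (Multiset.toFinsupp s)
    · obtain ⟨u, hu1, hu2⟩ := ih x h1 h3
      refine ⟨u + Finsupp.single (bot j) 1, ?_, ?_⟩
      · rw [Finsupp.mapDomain_add, hu1, Finsupp.mapDomain_single, hbot, hcons]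
        abel
      · rw [map_add, hu2]
        simp [Finsupp.weight_apply, hbot']
    · obtain ⟨u, hu1, hu2⟩ := ih (x - w j) (by omega) (by omega)
      refine ⟨u + Finsupp.single (top j) 1, ?_, ?_⟩
      · rw [Finsupp.mapDomain_add, hu1, Finsupp.mapDomain_single, htop, hcons]
        abel
      · rw [map_add, hu2]
        simp only [Finsupp.weight_apply, Finsupp.sum_single_index, zero_smul, one_smul, htop']
        omega

lemma fiberCount_colorDegree (κ : σ → ι) (φ : σ → ℕ) (s : ℕ) :
    fiberCount (colorDegree κ φ) s =
      ∑ n ∈ (finite_setOf_degree_eq (σ := ι) s).toFinset, (positions κ φ n).ncard := by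
  classical
  have hfin : (degreeMap (colorDegree κ φ) '' {u | u.degree = s}).Finite :=
    (finite_setOf_degree_eq s).image _
  rw [fiberCount, Set.ncard_eq_toFinset_card _ hfin,
    Finset.card_eq_sum_card_fiberwise (f := Prod.fst)
      (t := (finite_setOf_degree_eq (σ := ι) s).toFinset)]
  · refine Finset.sum_congr rfl fun n hn => ?_
    rw [Set.Finite.mem_toFinset, Set.mem_ofPred_eq] at hn
    rw [Set.ncard_eq_toFinset_card _ (finite_positions κ φ n), ← Finset.card_image_of_injective
      (finite_positions κ φ n).toFinset (Prod.mk_right_injective n)]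
    congr 1
    ext ⟨n', x⟩
    simp only [Finset.mem_filter, Set.Finite.mem_toFinset, Set.mem_image, Set.mem_ofPred_eq,
      degreeMap_colorDegree, Prod.mk.injEq, Finset.mem_image, positions]
    constructor
    · rintro ⟨⟨u, hu, h1, h2⟩, rfl⟩
      exact ⟨x, ⟨u, h1, h2⟩, rfl, rfl⟩
    · rintro ⟨_, ⟨u, h1, h2⟩, rfl, rfl⟩
      exact ⟨⟨u, by rw [← degree_mapDomain κ, h1, hn], h1, h2⟩, rfl⟩
  · intro y hy
    simp only [Set.Finite.coe_toFinset, Set.mem_image, Set.mem_ofPred_eq] at hy ⊢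
    obtain ⟨u, hu, rfl⟩ := hy
    rw [degreeMap_colorDegree, degree_mapDomain, hu]

lemma fiberCount_le (κ : σ → ι) (φ : σ → ℕ) (s : ℕ) :
    fiberCount (colorDegree κ φ) s ≤
      ((∑ p, φ p) * s + 1) * {n : ι →₀ ℕ | n.degree = s}.ncard := by
  rw [fiberCount_colorDegree, Set.ncard_eq_toFinset_card _ (finite_setOf_degree_eq s), mul_comm]
  refine Finset.sum_le_card_nsmul _ _ _ fun n hn => ?_
  rw [Set.Finite.mem_toFinset, Set.mem_ofPred_eq] at hn
  refine (Set.ncard_le_ncard (positions_subset κ φ n)).trans ?_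
  rw [hn, ← Finset.coe_Iic, Set.ncard_coe_finset, Nat.card_Iic]

lemma exists_sum_weight_le_fiberCount (hbot : ∀ j, κ (bot j) = j) (hbot' : ∀ j, φ (bot j) = 0)
    (htop : ∀ j, κ (top j) = j) (htop' : ∀ j, φ (top j) = w j) (hgcd : Finset.univ.gcd φ = 1) :
    ∃ b : ℕ, ∀ s, ∑ n ∈ (finite_setOf_degree_eq (σ := ι) s).toFinset, Finsupp.weight w n ≤
      fiberCount (colorDegree κ φ) (s + b) := by
  classical
  obtain ⟨N, K, hN⟩ := exists_interval_add hbot hbot' htop htop' hgcd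
  refine ⟨N.degree, fun s => ?_⟩
  rw [fiberCount_colorDegree]
  calc ∑ n ∈ (finite_setOf_degree_eq (σ := ι) s).toFinset, Finsupp.weight w n
      ≤ ∑ n ∈ (finite_setOf_degree_eq (σ := ι) s).toFinset, (positions κ φ (N + n)).ncard := by
        refine Finset.sum_le_sum fun n _ => ?_
        have h1 : Set.Icc K (K + Finsupp.weight w n) ⊆ positions κ φ (N + n) :=
          fun x hx => hN n x hx.1 hx.2
        have h2 := Set.ncard_le_ncard h1 (finite_positions κ φ _)
        rw [← Finset.coe_Icc, Set.ncard_coe_finset, Nat.card_Icc] at h2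
        omega
    _ = ∑ n ∈ ((finite_setOf_degree_eq (σ := ι) s).toFinset).image (N + ·),
          (positions κ φ n).ncard :=
        (Finset.sum_image (f := fun n => (positions κ φ n).ncard)
          ((add_right_injective N).injOn)).symm
    _ ≤ _ := by
        refine Finset.sum_le_sum_of_subset fun n hn => ?_
        obtain ⟨n, hn', rfl⟩ := Finset.mem_image.1 hn
        rw [Set.Finite.mem_toFinset, Set.mem_ofPred_eq] at hn' ⊢
        rw [map_add, hn', add_comm]

/-- The average of a linear form over the monomials of degree `s`. -/
lemma card_mul_sum_weight (w : ι → ℕ) (s : ℕ) :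
    Fintype.card ι * ∑ n ∈ (finite_setOf_degree_eq (σ := ι) s).toFinset, Finsupp.weight w n =
      (∑ j, w j) * s * {n : ι →₀ ℕ | n.degree = s}.ncard := by
  classical
  set D := (finite_setOf_degree_eq (σ := ι) s).toFinset with hD
  -- all coordinates have the same sum, by symmetry
  have hsymm : ∀ i j, ∑ n ∈ D, n i = ∑ n ∈ D, n j := by
    intro i j
    refine Finset.sum_bij' (fun n _ => n.mapDomain (Equiv.swap i j))
      (fun n _ => n.mapDomain (Equiv.swap i j)) ?_ ?_ ?_ ?_ ?_
    · intro n hn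
      simpa [hD, degree_mapDomain] using hn
    · intro n hn
      simpa [hD, degree_mapDomain] using hn
    · intro n _
      rw [← Finsupp.mapDomain_comp]
      convert Finsupp.mapDomain_id
      ext x
      simp
    · intro n _
      rw [← Finsupp.mapDomain_comp]
      convert Finsupp.mapDomain_id
      ext x
      simp
    · intro n _
      have := Finsupp.mapDomain_apply (Equiv.swap i j).injective n i
      rw [Equiv.swap_apply_left] at this
      exact this.symm
  have htotal : ∀ i, Fintype.card ι * ∑ n ∈ D, n i = s * D.card := by
    intro i
    calc Fintype.card ι * ∑ n ∈ D, n i = ∑ j : ι, ∑ n ∈ D, n j := by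
          rw [Finset.sum_congr rfl fun j _ => hsymm j i, Finset.sum_const, Finset.card_univ,
            smul_eq_mul]
      _ = ∑ n ∈ D, n.degree := by
          rw [Finset.sum_comm]
          simp [Finsupp.degree_eq_sum]
      _ = s * D.card := by
          rw [mul_comm, ← smul_eq_mul, ← Finset.sum_const]
          refine Finset.sum_congr rfl fun n hn => ?_
          simpa [hD] using hn
  calc Fintype.card ι * ∑ n ∈ D, Finsupp.weight w n
      = ∑ j, w j * (Fintype.card ι * ∑ n ∈ D, n j) := by
        simp only [Finsupp.weight_eq_sum, smul_eq_mul]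
        rw [Finset.sum_comm, Finset.mul_sum]
        refine Finset.sum_congr rfl fun j _ => ?_
        rw [← Finset.sum_mul]
        ring
    _ = (∑ j, w j) * s * D.card := by
        rw [Finset.sum_congr rfl fun j _ => by rw [htotal j], ← Finset.sum_mul, mul_assoc]
    _ = _ := by rw [Set.ncard_eq_toFinset_card _ (finite_setOf_degree_eq s)]

end Growth

section Degree

open Polynomial Filter

/-- Comparison of leading terms. -/
lemma natDegree_lt_or_leadingCoeff_le {p q : ℚ[X]} (hp : 0 < p.leadingCoeff)
    (h : ∀ᶠ s : ℕ in atTop, p.eval (s : ℚ) ≤ q.eval (s : ℚ)) :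
    p.natDegree < q.natDegree ∨ p.natDegree = q.natDegree ∧ p.leadingCoeff ≤ q.leadingCoeff := by
  have h1 : 0 ≤ (q - p).leadingCoeff :=
    leadingCoeff_nonneg_of_eventually_nonneg (h.mono fun s hs => by simpa using hs)
  rcases lt_trichotomy p.natDegree q.natDegree with h2 | h2 | h2
  · exact Or.inl h2
  · refine Or.inr ⟨h2, ?_⟩
    by_contra! h3
    have h4 : (q - p).coeff p.natDegree < 0 := by
      rw [Polynomial.coeff_sub, sub_neg]
      rw [leadingCoeff, leadingCoeff, ← h2] at h3
      exact h3
    have h5 : (q - p).natDegree = p.natDegree :=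
      natDegree_eq_of_le_of_coeff_ne_zero ((natDegree_sub_le _ _).trans (by simp [h2])) h4.ne
    rw [leadingCoeff, h5] at h1
    exact h1.not_gt h4
  · rw [leadingCoeff_sub_of_degree_lt' (degree_lt_degree h2)] at h1
    linarith

variable {σ ι : Type*} [Fintype σ] [Fintype ι] {κ : σ → ι} {φ : σ → ℕ} {w : ι → ℕ} {bot top : ι → σ}

/-- The degree of the toric variety is at least the sum of the widths of the colours. -/
theorem sum_width_le_degree [Nonempty ι] (hbot : ∀ j, κ (bot j) = j) (hbot' : ∀ j, φ (bot j) = 0)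
    (htop : ∀ j, κ (top j) = j) (htop' : ∀ j, φ (top j) = w j) (hgcd : Finset.univ.gcd φ = 1)
    {p : ℚ[X]} (hp : ∀ᶠ s : ℕ in atTop, p.eval (s : ℚ) = fiberCount (colorDegree κ φ) s) :
    ((∑ j, w j : ℕ) : ℚ) ≤ p.natDegree.factorial * p.leadingCoeff := by
  classical
  have hlc0 : 0 ≤ p.leadingCoeff :=
    leadingCoeff_nonneg_of_eventually_nonneg (hp.mono fun s hs => by rw [hs]; positivity)
  rcases Nat.eq_zero_or_pos (∑ j, w j) with hW | hW
  · rw [hW, Nat.cast_zero]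
    positivity
  obtain ⟨c, hc⟩ : ∃ c, Fintype.card ι = c + 1 := ⟨Fintype.card ι - 1, by
    have := Fintype.card_pos (α := ι); omega⟩
  let Q : ℚ[X] := preHilbertPoly ℚ c 0
  have hQd : Q.natDegree = c := natDegree_preHilbertPoly ℚ c 0
  have hQl : Q.leadingCoeff = (c.factorial : ℚ)⁻¹ := leadingCoeff_preHilbertPoly ℚ c 0
  have hQ0 : Q ≠ 0 := by
    rw [← leadingCoeff_ne_zero, hQl]
    positivity
  have hQ : ∀ s : ℕ, Q.eval (s : ℚ) = {n : ι →₀ ℕ | n.degree = s}.ncard := fun s => by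
    rw [ncard_degree_eq_eval, hc]
    rfl
  -- the lower bound
  obtain ⟨b, hb⟩ := exists_sum_weight_le_fiberCount hbot hbot' htop htop' hgcd
  let A : ℚ[X] := Polynomial.C ((∑ j, w j : ℕ) / (c + 1) : ℚ) * (Polynomial.X * Q)
  have hAl : A.leadingCoeff = (∑ j, w j : ℕ) / ((c + 1).factorial : ℚ) := by
    rw [leadingCoeff_mul, leadingCoeff_C, leadingCoeff_mul, leadingCoeff_X, hQl,
      Nat.factorial_succ]
    push_cast
    field_simp
  have hA0 : 0 < A.leadingCoeff := by rw [hAl]; positivity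
  have hAd : A.natDegree = c + 1 := by
    rw [natDegree_C_mul (by positivity), natDegree_X_mul hQ0, hQd]
  have hlower : ∀ᶠ s : ℕ in atTop, A.eval (s : ℚ) ≤
      (p.comp (Polynomial.X + Polynomial.C (b : ℚ))).eval (s : ℚ) := by
    filter_upwards [(tendsto_add_atTop_nat b).eventually hp] with s hs
    have h1 : (((c + 1 : ℕ) : ℚ)) * ((∑ n ∈ (finite_setOf_degree_eq (σ := ι) s).toFinset,
        Finsupp.weight w n : ℕ) : ℚ) = (∑ j, w j : ℕ) * s * {n : ι →₀ ℕ | n.degree = s}.ncard := by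
      rw [← hc]
      exact_mod_cast card_mul_sum_weight w s
    have h2 : ((∑ n ∈ (finite_setOf_degree_eq (σ := ι) s).toFinset,
        Finsupp.weight w n : ℕ) : ℚ) ≤ fiberCount (colorDegree κ φ) (s + b) := by
      exact_mod_cast hb s
    have h3 : (p.comp (Polynomial.X + Polynomial.C (b : ℚ))).eval (s : ℚ) =
        fiberCount (colorDegree κ φ) (s + b) := by
      rw [← hs]
      simp
    rw [h3]
    refine le_trans (le_of_eq ?_) h2
    simp only [A, Polynomial.eval_mul, Polynomial.eval_C, Polynomial.eval_X, hQ]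
    rw [div_mul_eq_mul_div, div_eq_iff (by positivity), ← mul_assoc, ← h1]
    push_cast
    ring
  -- the upper bound
  let B : ℚ[X] := (Polynomial.C ((∑ q, φ q : ℕ) : ℚ) * Polynomial.X + Polynomial.C 1) * Q
  have hBd : B.natDegree ≤ c + 1 := by
    refine natDegree_mul_le.trans ?_
    rw [hQd, add_comm]
    gcongr
    exact natDegree_linear_le
  have hupper : ∀ᶠ s : ℕ in atTop, p.eval (s : ℚ) ≤ B.eval (s : ℚ) := by
    filter_upwards [hp] with s hs
    rw [hs]
    simp only [B, Polynomial.eval_mul, Polynomial.eval_add, Polynomial.eval_C, Polynomial.eval_X,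
      hQ]
    exact_mod_cast fiberCount_le κ φ s
  have hcd : (p.comp (Polynomial.X + Polynomial.C (b : ℚ))).natDegree = p.natDegree := by
    rw [natDegree_comp, natDegree_X_add_C, mul_one]
  have hcl : (p.comp (Polynomial.X + Polynomial.C (b : ℚ))).leadingCoeff = p.leadingCoeff := by
    rw [leadingCoeff_comp (by rw [natDegree_X_add_C]; exact one_ne_zero), leadingCoeff_X_add_C,
      one_pow, mul_one]
  have h1 := natDegree_lt_or_leadingCoeff_le hA0 hlower
  rw [hcd, hcl, hAd] at h1
  have hpl : 0 < p.leadingCoeff := by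
    refine lt_of_le_of_ne hlc0 fun h => ?_
    rw [eq_comm, leadingCoeff_eq_zero] at h
    rw [h, natDegree_zero, leadingCoeff_zero] at h1
    omega
  have h2 : p.natDegree ≤ c + 1 := by
    rcases natDegree_lt_or_leadingCoeff_le hpl hupper with h | h <;> omega
  rcases h1 with h1 | ⟨h1, h3⟩
  · omega
  · rw [hAl, div_le_iff₀ (by positivity), h1, mul_comm] at h3
    exact h3

end Degree

/-! ### The ideal of a scroll is toric -/

section Scroll

variable {k : Type*} [Field k] {c : ℕ} {a : Fin c → ℕ}

/-- The degrees of the coordinates in the parametrization `x_{j,i} ↦ t_j s^i` of the scroll, with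
the position `i` counted from `0`. -/
def scrollDegree (a : Fin c → ℕ) : Coord a → (Fin c →₀ ℕ) × ℕ :=
  colorDegree (fun p => p.1) fun p => (p.2 : ℕ)

lemma scrollDegree_injective (a : Fin c → ℕ) : Function.Injective (scrollDegree a) := by
  rintro ⟨j, i⟩ ⟨j', i'⟩ h
  simp only [scrollDegree, colorDegree, Prod.mk.injEq] at h
  obtain ⟨h1, h2⟩ := h
  obtain rfl := Finsupp.single_left_injective one_ne_zero h1
  rw [Fin.ext h2]

lemma minor_eq (p q : Σ j : Fin c, Fin (a j)) :
    ((scrollMatrix k a).submatrix id ![p, q]).det =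
      monomial (Finsupp.single ⟨p.1, p.2.castSucc⟩ 1 + Finsupp.single ⟨q.1, q.2.succ⟩ 1) 1 -
      monomial (Finsupp.single ⟨q.1, q.2.castSucc⟩ 1 + Finsupp.single ⟨p.1, p.2.succ⟩ 1) 1 := by
  rw [Matrix.det_fin_two]
  simp [scrollMatrix, X, monomial_mul]

lemma scrollIdeal_le_toricIdeal : scrollIdeal k a ≤ toricIdeal k (scrollDegree a) := by
  rw [scrollIdeal, Ideal.span_le]
  rintro _ ⟨⟨p, q⟩, rfl⟩
  simp only [SetLike.mem_coe, minor_eq]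
  refine monomial_sub_mem_toricIdeal ?_
  simp only [map_add, degreeMap_single, scrollDegree, colorDegree, one_smul, Fin.val_castSucc,
    Fin.val_succ, Prod.mk_add_mk, Prod.mk.injEq]
  exact ⟨add_comm _ _, by omega⟩

lemma monomial_add_sub_mem {σ : Type*} {I : Ideal (MvPolynomial σ k)} {u v : σ →₀ ℕ}
    (h : monomial u (1 : k) - monomial v 1 ∈ I) (z : σ →₀ ℕ) :
    monomial (u + z) (1 : k) - monomial (v + z) 1 ∈ I := by
  have := I.mul_mem_right (monomial z 1) h
  rwa [sub_mul, monomial_mul, monomial_mul, one_mul] at this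

lemma degreeMap_eq_of_monomial_sub_mem {σ M : Type*} [AddCommMonoid M] {γ : σ → M} {u v : σ →₀ ℕ}
    (h : monomial u (1 : k) - monomial v 1 ∈ toricIdeal k γ) : degreeMap γ u = degreeMap γ v := by
  rw [toricIdeal, RingHom.mem_ker, map_sub, toricMap_monomial, toricMap_monomial, sub_eq_zero,
    AddMonoidAlgebra.single_left_inj one_ne_zero] at h
  exact h

/-- Inductive step: two monomials of the same degree are congruent modulo the minors if they
involve coordinates `x_{j,i}` and `x_{j,i'}` of the same block. A further coordinate `x_{l,m}` with
`m > 0` allows to move `x_{j,i}` closer to `x_{j,i'}`, by a minor; when the two meet they can be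
cancelled. -/
lemma monomial_sub_mem_scrollIdeal_of_le {n : ℕ}
    (ih : ∀ u v : Coord a →₀ ℕ, u.degree = n → degreeMap (scrollDegree a) u =
      degreeMap (scrollDegree a) v → monomial u (1 : k) - monomial v 1 ∈ scrollIdeal k a)
    {j : Fin c} (e : ℕ) (i i' : Fin (a j + 1)) (he : (i : ℕ) + e = i') (u v : Coord a →₀ ℕ)
    (hu : u.degree = n + 1) (huv : degreeMap (scrollDegree a) u = degreeMap (scrollDegree a) v)
    (hi : u ⟨j, i⟩ ≠ 0) (hi' : v ⟨j, i'⟩ ≠ 0) :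
    monomial u (1 : k) - monomial v 1 ∈ scrollIdeal k a := by
  classical
  induction e generalizing i u with
  | zero =>
    obtain rfl : i = i' := Fin.ext he
    obtain ⟨u, rfl⟩ := exists_add_of_le (Finsupp.single_le_iff.2 (Nat.one_le_iff_ne_zero.2 hi))
    obtain ⟨v, rfl⟩ := exists_add_of_le (Finsupp.single_le_iff.2 (Nat.one_le_iff_ne_zero.2 hi'))
    rw [map_add, map_add] at huv
    rw [map_add, Finsupp.degree_single] at hu
    rw [add_comm _ u, add_comm _ v]
    exact monomial_add_sub_mem (ih u v (by omega) (add_left_cancel huv)) _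
  | succ e ihe =>
    obtain ⟨u, rfl⟩ := exists_add_of_le (Finsupp.single_le_iff.2 (Nat.one_le_iff_ne_zero.2 hi))
    have hia : (i : ℕ) < a j := by have := i'.isLt; omega
    obtain ⟨x, hx, hx0⟩ : ∃ x : Coord a, u x ≠ 0 ∧ (x.2 : ℕ) ≠ 0 := by
      -- otherwise the total position of the first monomial is less than `i'`
      by_contra! hcon
      have h1 := congrArg Prod.snd huv
      simp only [scrollDegree, degreeMap_colorDegree, map_add, Prod.mk_add_mk] at h1
      have h2 : Finsupp.weight (fun p : Coord a => (p.2 : ℕ)) u = 0 := by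
        rw [Finsupp.weight_eq_sum]
        refine Finset.sum_eq_zero fun x _ => ?_
        by_cases hx : u x = 0
        · simp [hx]
        · simp [hcon x hx]
      have h3 := Finsupp.le_weight_of_ne_zero' (w := fun p : Coord a => (p.2 : ℕ)) hi'
      rw [← h1, h2] at h3
      simp [Finsupp.weight_apply] at h3
      omega
    obtain ⟨u, rfl⟩ := exists_add_of_le (Finsupp.single_le_iff.2 (Nat.one_le_iff_ne_zero.2 hx))
    obtain ⟨l, m⟩ := x
    obtain ⟨m, rfl⟩ : ∃ m' : Fin (a l), m = m'.succ :=
      ⟨m.pred (fun h => hx0 (by simp [h])), by simp⟩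
    obtain ⟨i, rfl⟩ : ∃ i₀ : Fin (a j), i = i₀.castSucc := ⟨⟨i, hia⟩, by ext; simp⟩
    let u' : Coord a →₀ ℕ := Finsupp.single ⟨l, m.castSucc⟩ 1 + Finsupp.single ⟨j, i.succ⟩ 1 + u
    have hmove : monomial (Finsupp.single (⟨j, i.castSucc⟩ : Coord a) 1 +
        (Finsupp.single ⟨l, m.succ⟩ 1 + u)) (1 : k) - monomial u' 1 ∈ scrollIdeal k a := by
      rw [← add_assoc]
      refine monomial_add_sub_mem ?_ u
      refine Ideal.subset_span ⟨(⟨j, i⟩, ⟨l, m⟩), ?_⟩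
      exact minor_eq (k := k) (a := a) ⟨j, i⟩ ⟨l, m⟩
    have hF := degreeMap_eq_of_monomial_sub_mem (scrollIdeal_le_toricIdeal hmove)
    have hrest := ihe i.succ (by simp at he ⊢; omega) u'
      ((degree_eq_of_degreeMap_colorDegree_eq hF).symm.trans hu) (hF.symm.trans huv)
      (by simp [u'])
    have := add_mem hmove hrest
    rwa [sub_add_sub_cancel] at this

lemma monomial_sub_mem_scrollIdeal (u v : Coord a →₀ ℕ)
    (huv : degreeMap (scrollDegree a) u = degreeMap (scrollDegree a) v) :
    monomial u (1 : k) - monomial v 1 ∈ scrollIdeal k a := by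
  classical
  obtain ⟨n, hn⟩ : ∃ n, u.degree = n := ⟨_, rfl⟩
  have hv := (degree_eq_of_degreeMap_colorDegree_eq huv).symm.trans hn
  induction n generalizing u v with
  | zero =>
    rw [Finsupp.degree_eq_zero_iff] at hn hv
    rw [hn, hv, sub_self]
    exact zero_mem _
  | succ n ih =>
    have ih' : ∀ u v : Coord a →₀ ℕ, u.degree = n → degreeMap (scrollDegree a) u =
        degreeMap (scrollDegree a) v → monomial u (1 : k) - monomial v 1 ∈ scrollIdeal k a :=
      fun u v hu huv => ih u v huv hu ((degree_eq_of_degreeMap_colorDegree_eq huv).symm.trans hu)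
    obtain ⟨⟨j, i⟩, hi⟩ : ∃ x, u x ≠ 0 := by
      by_contra! hcon
      rw [show u = 0 from Finsupp.ext hcon, map_zero] at hn
      omega
    have hcol : u.mapDomain Sigma.fst = v.mapDomain Sigma.fst := by
      have h1 := congrArg Prod.fst huv
      simpa only [scrollDegree, degreeMap_colorDegree] using h1
    obtain ⟨i', hi'⟩ : ∃ i', v ⟨j, i'⟩ ≠ 0 := by
      have h1 : j ∈ (v.mapDomain Sigma.fst).support := by
        rw [← hcol, Finsupp.mem_support_iff]
        obtain ⟨w, rfl⟩ := exists_add_of_le (Finsupp.single_le_iff.2 (Nat.one_le_iff_ne_zero.2 hi))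
        simp [Finsupp.mapDomain_add, Finsupp.mapDomain_single]
      obtain ⟨⟨j', i'⟩, h2, rfl⟩ := Finset.mem_image.1 (Finsupp.mapDomain_support h1)
      exact ⟨i', Finsupp.mem_support_iff.1 h2⟩
    rcases le_total (i : ℕ) i' with h | h
    · exact monomial_sub_mem_scrollIdeal_of_le ih' _ i i' (Nat.add_sub_of_le h) u v hn huv hi hi'
    · have := monomial_sub_mem_scrollIdeal_of_le ih' _ i' i (Nat.add_sub_of_le h) v u hv huv.symm
        hi' hi
      rw [← neg_sub]
      exact neg_mem this

theorem scrollIdeal_eq_toricIdeal (k : Type*) [Field k] (a : Fin c → ℕ) :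
    scrollIdeal k a = toricIdeal k (scrollDegree a) :=
  le_antisymm scrollIdeal_le_toricIdeal (toricIdeal_le monomial_sub_mem_scrollIdeal)

/-- Projecting a toric variety to coordinate hyperplanes restricts its parametrization. -/
lemma IsIteratedProjection.eq_toricIdeal {σ M : Type*} [Fintype σ] [DecidableEq σ] [AddCommMonoid M]
    {γ : σ → M} {T : Finset σ} {J : Ideal (MvPolynomial T k)}
    (h : IsIteratedProjection (toricIdeal k γ) T J) : J = toricIdeal k fun p : T => γ p := by
  induction h with
  | start => exact comap_rename_toricIdeal γ _
  | project _ x hx ih =>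
    rw [ih]
    exact comap_rename_toricIdeal _ _

end Scroll

/-! ### The degree bound -/

section Bound

variable {σ ι k : Type*} [Field k]

lemma exists_hasProjectiveDegree_toricIdeal [Finite σ] (κ : σ → ι) (φ : σ → ℕ) :
    ∃ (p : Polynomial ℚ) (d : ℕ),
      (∀ᶠ s : ℕ in Filter.atTop, p.eval (s : ℚ) = fiberCount (colorDegree κ φ) s) ∧
      (d : ℚ) = (p.natDegree.factorial : ℚ) * p.leadingCoeff ∧
      HasProjectiveDegree (toricIdeal k (colorDegree κ φ)) d := by
  obtain ⟨p, hp⟩ := isEventuallyPolynomial_fiberCount (γ := colorDegree κ φ)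
    fun _ _ => degree_eq_of_degreeMap_colorDegree_eq
  obtain ⟨d, hd⟩ := exists_natCast_eq_factorial_mul_leadingCoeff hp
  refine ⟨p, d, hp, hd, p, ?_, hd⟩
  filter_upwards [hp] with s hs
  rw [hs, hilbertFunction_toricIdeal]

lemma IsReducedGroebnerBasis.totalDegree_le {κ : σ → ι} {φ : σ → ℕ} {m : MonomialOrder σ}
    {G : Set (MvPolynomial σ k)}
    (hG : IsReducedGroebnerBasis m (toricIdeal k (colorDegree κ φ)) G) {d : ℕ}
    (hd : ∀ u v, IsPrimitivePair (colorDegree κ φ) u v → u.degree ≤ d) {g : MvPolynomial σ k}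
    (hg : g ∈ G) : g.totalDegree ≤ d := by
  obtain ⟨v, hv⟩ := hG.exists_isPrimitivePair hg
  refine Finset.sup_le fun u hu => le_trans (le_of_eq ?_) (hd _ _ hv)
  exact degree_eq_of_degreeMap_colorDegree_eq (hG.degreeMap_eq hg hu)

lemma weight_eq_add_weight_mapDomain (κ : σ → ι) {φ ψ : σ → ℕ} {e : ι → ℕ}
    (h : ∀ p, φ p = ψ p + e (κ p)) (u : σ →₀ ℕ) :
    Finsupp.weight φ u = Finsupp.weight ψ u + Finsupp.weight e (u.mapDomain κ) := by
  induction u using Finsupp.induction_linear with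
  | zero => simp
  | add u v hu hv => rw [Finsupp.mapDomain_add, map_add, map_add, map_add, hu, hv]; ring
  | single p n =>
    simp [Finsupp.mapDomain_single, Finsupp.weight_apply, h, mul_add]

/-- The positions may be shifted within each colour, divided by a common factor, and unused colours
may be dropped, without changing the toric ideal. -/
lemma degreeMap_colorDegree_eq_iff [Fintype σ] {τ : Type*} {κ : σ → ι} {κ' : σ → τ} {f : τ → ι}
    (hf : Function.Injective f) (hκ : ∀ p, κ p = f (κ' p)) {φ φ' : σ → ℕ} {e : τ → ℕ} {g : ℕ}
    (hg : g ≠ 0) (hφ : ∀ p, φ p = g * φ' p + e (κ' p)) (u v : σ →₀ ℕ) :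
    degreeMap (colorDegree κ φ) u = degreeMap (colorDegree κ φ) v ↔
      degreeMap (colorDegree κ' φ') u = degreeMap (colorDegree κ' φ') v := by
  have h1 : κ = f ∘ κ' := funext hκ
  have h2 : ∀ u : σ →₀ ℕ, Finsupp.weight (fun p => g * φ' p) u = g * Finsupp.weight φ' u := by
    intro u
    rw [Finsupp.weight_eq_sum, Finsupp.weight_eq_sum, Finset.mul_sum]
    exact Finset.sum_congr rfl fun p _ => by simp only [smul_eq_mul]; ring
  simp only [degreeMap_colorDegree, Prod.mk.injEq, weight_eq_add_weight_mapDomain κ' hφ, h2, h1,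
    Finsupp.mapDomain_comp, (Finsupp.mapDomain_injective hf).eq_iff]
  refine and_congr_right fun h3 => ?_
  rw [h3, Nat.add_right_cancel_iff, Nat.mul_right_inj hg]

theorem exists_degree_bound [Fintype σ] [LinearOrder ι] {κ : σ → ι} {φ : σ → ℕ}
    (hinj : Function.Injective (colorDegree κ φ)) :
    ∃ d : ℕ, HasProjectiveDegree (toricIdeal k (colorDegree κ φ)) d ∧
      ∀ (m : MonomialOrder σ) (G : Set (MvPolynomial σ k)),
        IsReducedGroebnerBasis m (toricIdeal k (colorDegree κ φ)) G →
          ∀ g ∈ G, g.totalDegree ≤ d := by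
  classical
  let κ' : σ → Set.range κ := Set.rangeFactorization κ
  have hκ : ∀ p, κ p = (κ' p : ι) := fun _ => rfl
  have hmin : ∀ j : Set.range κ, ∃ p, κ' p = j ∧ ∀ q, κ' q = j → φ p ≤ φ q := by
    intro j
    obtain ⟨p, hp⟩ := Set.rangeFactorization_surjective j
    obtain ⟨q, hq, hq'⟩ := Set.exists_min_image {p | κ' p = j} φ (Set.toFinite _) ⟨p, hp⟩
    exact ⟨q, hq, hq'⟩
  choose bot hbot hbot' using hmin
  let ψ : σ → ℕ := fun p => φ p - φ (bot (κ' p))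
  have hψ : ∀ p, φ p = ψ p + φ (bot (κ' p)) := fun p =>
    (Nat.sub_add_cancel (hbot' _ p rfl)).symm
  by_cases hψ0 : ∀ p, ψ p = 0
  · -- all widths are zero, the variety is a linear space and its ideal is zero
    obtain ⟨p, d, -, -, hd⟩ := exists_hasProjectiveDegree_toricIdeal (k := k) κ φ
    refine ⟨d, hd, fun m G hG g hg => hG.totalDegree_le (fun u v huv => ?_) hg⟩
    have hκinj : Function.Injective κ := by
      intro p q hpq
      refine hinj (Prod.ext (by simp [colorDegree, hpq]) ?_)
      have : κ' p = κ' q := Subtype.ext hpq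
      simp only [colorDegree]
      rw [hψ p, hψ q, hψ0, hψ0, this]
    have h1 := congrArg Prod.fst huv.degreeMap_eq
    simp only [degreeMap_colorDegree] at h1
    exact absurd (Finsupp.mapDomain_injective hκinj h1) huv.ne
  · push Not at hψ0
    obtain ⟨p₀, hp₀⟩ := hψ0
    obtain ⟨φ', hφ', hgcd⟩ := Finset.extract_gcd ψ ⟨p₀, Finset.mem_univ p₀⟩
    have hg : Finset.univ.gcd ψ ≠ 0 := fun h =>
      hp₀ (Finset.gcd_eq_zero_iff.1 h p₀ (Finset.mem_univ _))
    have hφ : ∀ p, φ p = Finset.univ.gcd ψ * φ' p + φ (bot (κ' p)) := fun p => by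
      rw [← hφ' p (Finset.mem_univ p)]
      exact hψ p
    have hbot0 : ∀ j, φ' (bot j) = 0 := by
      intro j
      have h1 := hφ (bot j)
      rw [hbot j] at h1
      have h2 : Finset.univ.gcd ψ * φ' (bot j) = 0 := by omega
      exact (Nat.mul_eq_zero.1 h2).resolve_left hg
    have hmax : ∀ j : Set.range κ, ∃ p, κ' p = j ∧ ∀ q, κ' q = j → φ' q ≤ φ' p := by
      intro j
      obtain ⟨q, hq, hq'⟩ := Set.exists_max_image {p | κ' p = j} φ' (Set.toFinite _)
        ⟨bot j, hbot j⟩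
      exact ⟨q, hq, hq'⟩
    choose top htop htop' using hmax
    have hinj' : Function.Injective (colorDegree κ' φ') := by
      intro p q hpq
      simp only [colorDegree, Prod.mk.injEq] at hpq
      have h1 : κ' p = κ' q := Finsupp.single_left_injective one_ne_zero hpq.1
      refine hinj (Prod.ext ?_ ?_)
      · simp only [colorDegree, hκ, h1]
      · simp only [colorDegree]
        rw [hφ p, hφ q, h1, hpq.2]
    rw [toricIdeal_congr (degreeMap_colorDegree_eq_iff Subtype.val_injective hκ hg
      (e := fun j => φ (bot j)) hφ)]
    have : Fintype (Set.range κ) := Fintype.ofFinite _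
    have : Nonempty (Set.range κ) := ⟨κ' p₀⟩
    obtain ⟨p, d, hp, hpd, hd⟩ := exists_hasProjectiveDegree_toricIdeal (k := k) κ' φ'
    refine ⟨d, hd, fun m G hG g hg => hG.totalDegree_le (fun u v huv => ?_) hg⟩
    have h1 := sum_width_le_degree (w := fun j => φ' (top j)) hbot hbot0 htop (fun _ => rfl) hgcd hp
    rw [← hpd] at h1
    exact (huv.degree_le hinj' (w := fun j => φ' (top j)) fun p q hpq =>
      (htop' _ p hpq).trans le_add_self).trans (by exact_mod_cast h1)

end Bound

end ScrollProjection

end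


theorem mainTheorem4 {k : Type*} [Field k] {c : ℕ} (a : Fin c → ℕ)
    (T : Finset (ScrollProjection.Coord a)) (J : Ideal (MvPolynomial T k))
    (hJ : ScrollProjection.IsIteratedProjection (ScrollProjection.scrollIdeal k a) T J) :
    ∃ d : ℕ, ScrollProjection.HasProjectiveDegree J d ∧
      ∀ (m : MonomialOrder T) (G : Set (MvPolynomial T k)),
        ScrollProjection.IsReducedGroebnerBasis m J G → ∀ g ∈ G, g.totalDegree ≤ d := by
  rw [ScrollProjection.scrollIdeal_eq_toricIdeal] at hJ
  rw [hJ.eq_toricIdeal]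
  exact ScrollProjection.exists_degree_bound
    (κ := fun p : T => p.1.1) (φ := fun p : T => (p.1.2 : ℕ))
    ((ScrollProjection.scrollDegree_injective a).comp Subtype.val_injective)
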